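/- **Conventions.** A *partial matrix* is a symmetric $n\times n$ matrix $M=(m_{ij})$ with zero diagonal, each of whose off-diagonal entries is either a specified number in $\mathbb{R}_{\ge 0}$ or unspecified. A pair $(M,d)$ with $d\ge 1$ an integer is an *instance* of $d$-EDMC (Euclidean distance matrix completion); it is a *yes-instance* if there are points $p_1,\dots,p_n\in\mathbb{R}^d$, not necessarily distinct, with $\|p_i-p_j\|_2^2=m_{ij}$ for every specified entry $m_{ij}$, and a *no-instance* otherwise. Two instances are *equivalent* if both are yes-instances or both are no-instances. $M$ *excludes a $t$-block pattern* if there are no disjoint sets $I_1,I_2\subseteq\{1,\dots,n\}$ with $|I_1|=|I_2|=t$ such that $m_{ij}$ is unspecified for all $i\in I_1$, $j\in I_2$. Algorithms run on a real RAM: arithmetic operations and comparisons of real numbers take unit time, and running time is measured in terms of $n$. **Theorem (Compression for $K_{t,t}$-free complements).** There are an absolute constant $C$ and a polynomial-time algorithm that, given an instance $(M,d)$ of $d$-EDMC, either correctly decides whether $(M,d)$ is a yes-instance, or outputs an equivalent instance $(M',d)$ in which $M'$ is a (nonempty) principal submatrix of $M$ such that, for every $t\ge 1$ for which $M$ excludes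 a $t$-block pattern, $M'$ has at most $(d+1)^{Ct^2}$ rows and columns. -/

import Mathlib

/-- An `n × n` partial matrix: every entry is a real number or unspecified (`none`); it is symmetric,
its diagonal is specified and zero, and its specified entries are nonnegative. -/
structure PartialMatrix (n : ℕ) where
  entry : Fin n → Fin n → Option ℝ
  symm : ∀ i j, entry i j = entry j i
  diag : ∀ i, entry i i = some 0
  nonneg : ∀ i j x, entry i j = some x → 0 ≤ x

namespace PartialMatrix

/-- The principal submatrix on the rows and columns listed, in increasing order, by `f`. -/
def principal {m n : ℕ} (M : PartialMatrix n) (f : Fin m ↪o Fin n) : PartialMatrix m where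
  entry i j := M.entry (f i) (f j)
  symm i j := M.symm (f i) (f j)
  diag i := M.diag (f i)
  nonneg i j := M.nonneg (f i) (f j)

/-- `M` excludes a `t`-block pattern: there are no disjoint sets of `t` rows and `t` columns
all of whose common entries are unspecified. -/
def ExcludesBlock {n : ℕ} (M : PartialMatrix n) (t : ℕ) : Prop :=
  ¬ ∃ I J : Finset (Fin n), Disjoint I J ∧ I.card = t ∧ J.card = t ∧
    ∀ i ∈ I, ∀ j ∈ J, M.entry i j = none

end PartialMatrix

/-- `D` is the matrix of squared distances of `n` (not necessarily distinct) points of `ℝ^d`. -/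
def IsEDM {n : ℕ} (d : ℕ) (D : Matrix (Fin n) (Fin n) ℝ) : Prop :=
  ∃ p : Fin n → EuclideanSpace ℝ (Fin d), ∀ i j, D i j = ‖p i - p j‖ ^ 2

/-- `(M, d)` is a yes-instance: some Euclidean distance matrix in `ℝ^d` agrees with all the
specified entries of `M`. -/
def PartialMatrix.Completable {n : ℕ} (M : PartialMatrix n) (d : ℕ) : Prop :=
  ∃ D : Matrix (Fin n) (Fin n) ℝ, IsEDM d D ∧ ∀ i j x, M.entry i j = some x → D i j = x

/-! ### A real RAM

The memory consists of arrays of natural numbers and arrays of real numbers, whose cells are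
addressed by two computed natural numbers. A program mentions finitely many arrays by name.
Natural numbers can be added, subtracted (truncated at `0`) and compared; real numbers can be added,
subtracted, multiplied, divided and compared. A natural number can be converted to a real number,
but there is no way back (no rounding), and the only constants are natural numbers. Every operation
and every memory access costs one unit of time. -/
namespace RealRAM

/-- `nat a i j` and `real a i j` are the contents of cell `(i, j)` of the `a`-th array. -/
@[ext]
structure State where
  nat : ℕ → ℕ → ℕ → ℕ
  real : ℕ → ℕ → ℕ → ℝ

/-- Expressions with a natural number as value. -/
inductive NatExpr where
  | const (c : ℕ)
  | cell (a : ℕ) (i j : NatExpr)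
  | add (e f : NatExpr)
  | sub (e f : NatExpr)

namespace NatExpr

def eval (s : State) : NatExpr → ℕ
  | const c => c
  | cell a i j => s.nat a (i.eval s) (j.eval s)
  | add e f => e.eval s + f.eval s
  | sub e f => e.eval s - f.eval s

def cost : NatExpr → ℕ
  | const _ => 1
  | cell _ i j => i.cost + j.cost + 1
  | add e f => e.cost + f.cost + 1
  | sub e f => e.cost + f.cost + 1

end NatExpr

/-- Expressions with a real number as value; a quotient by zero has the value zero. -/
inductive RealExpr where
  | ofNat (e : NatExpr)
  | cell (a : ℕ) (i j : NatExpr)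
  | add (e f : RealExpr)
  | sub (e f : RealExpr)
  | mul (e f : RealExpr)
  | div (e f : RealExpr)

namespace RealExpr

noncomputable def eval (s : State) : RealExpr → ℝ
  | ofNat e => (e.eval s : ℝ)
  | cell a i j => s.real a (i.eval s) (j.eval s)
  | add e f => e.eval s + f.eval s
  | sub e f => e.eval s - f.eval s
  | mul e f => e.eval s * f.eval s
  | div e f => e.eval s / f.eval s

def cost : RealExpr → ℕ
  | ofNat e => e.cost + 1
  | cell _ i j => i.cost + j.cost + 1
  | add e f => e.cost + f.cost + 1
  | sub e f => e.cost + f.cost + 1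
  | mul e f => e.cost + f.cost + 1
  | div e f => e.cost + f.cost + 1

end RealExpr

/-- Tests. -/
inductive Cond where
  | natLE (e f : NatExpr)
  | realLE (e f : RealExpr)
  | neg (c : Cond)
  | conj (b c : Cond)

namespace Cond

def Holds (s : State) : Cond → Prop
  | natLE e f => e.eval s ≤ f.eval s
  | realLE e f => e.eval s ≤ f.eval s
  | neg c => ¬ c.Holds s
  | conj b c => b.Holds s ∧ c.Holds s

def cost : Cond → ℕ
  | natLE e f => e.cost + f.cost + 1
  | realLE e f => e.cost + f.cost + 1
  | neg c => c.cost + 1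
  | conj b c => b.cost + c.cost + 1

end Cond

/-- Programs; `loop c p` repeats `p` as long as `c` holds. -/
inductive Prog where
  | skip
  | setNat (a : ℕ) (i j : NatExpr) (e : NatExpr)
  | setReal (a : ℕ) (i j : NatExpr) (e : RealExpr)
  | seq (p q : Prog)
  | ite (c : Cond) (p q : Prog)
  | loop (c : Cond) (p : Prog)

namespace State

/-- Write `x` into cell `(i, j)` of the `a`-th array of natural numbers. -/
def setNat (s : State) (a i j x : ℕ) : State where
  nat a' i' j' := if a' = a ∧ i' = i ∧ j' = j then x else s.nat a' i' j'
  real := s.real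

/-- Write `x` into cell `(i, j)` of the `a`-th array of real numbers. -/
noncomputable def setReal (s : State) (a i j : ℕ) (x : ℝ) : State where
  nat := s.nat
  real a' i' j' := if a' = a ∧ i' = i ∧ j' = j then x else s.real a' i' j'

end State

/-- `Exec p s s' k`: started in state `s`, the program `p` halts in state `s'` after `k` steps. -/
inductive Exec : Prog → State → State → ℕ → Prop
  | skip (s : State) : Exec .skip s s 1
  | setNat (s : State) (a : ℕ) (i j e : NatExpr) :
      Exec (.setNat a i j e) s (s.setNat a (i.eval s) (j.eval s) (e.eval s))
        (i.cost + j.cost + e.cost + 1)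
  | setReal (s : State) (a : ℕ) (i j : NatExpr) (e : RealExpr) :
      Exec (.setReal a i j e) s (s.setReal a (i.eval s) (j.eval s) (e.eval s))
        (i.cost + j.cost + e.cost + 1)
  | seq {p q : Prog} {s s' s'' : State} {k l : ℕ} :
      Exec p s s' k → Exec q s' s'' l → Exec (.seq p q) s s'' (k + l)
  | ite_true {c : Cond} {p q : Prog} {s s' : State} {k : ℕ} :
      c.Holds s → Exec p s s' k → Exec (.ite c p q) s s' (c.cost + 1 + k)
  | ite_false {c : Cond} {p q : Prog} {s s' : State} {k : ℕ} :
      ¬ c.Holds s → Exec q s s' k → Exec (.ite c p q) s s' (c.cost + 1 + k)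
  | loop_true {c : Cond} {p : Prog} {s s' s'' : State} {k l : ℕ} :
      c.Holds s → Exec p s s' k → Exec (.loop c p) s' s'' l →
        Exec (.loop c p) s s'' (c.cost + 1 + k + l)
  | loop_false {c : Cond} {p : Prog} {s : State} :
      ¬ c.Holds s → Exec (.loop c p) s s (c.cost + 1)

/-- How an instance `(M, d)` is stored: the size `n` and the dimension `d` are in cell `(0, 0)` of
the arrays `0` and `1` of natural numbers, array `2` of natural numbers tells which entries are
specified, and array `0` of real numbers holds the specified entries. -/
def Encodes (s : State) {n : ℕ} (M : PartialMatrix n) (d : ℕ) : Prop :=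
  s.nat 0 0 0 = n ∧ s.nat 1 0 0 = d ∧
    ∀ i j : Fin n, s.nat 2 i j = (if (M.entry i j).isSome then 1 else 0) ∧
      ∀ x, M.entry i j = some x → s.real 0 i j = x

/-- The initial state on input `(M, d)`: the instance is stored as in `Encodes`, and all other
cells contain `0`. -/
noncomputable def input {n : ℕ} (M : PartialMatrix n) (d : ℕ) : State where
  nat a i j :=
    if a = 0 ∧ i = 0 ∧ j = 0 then n
    else if a = 1 ∧ i = 0 ∧ j = 0 then d
    else if h : a = 2 ∧ i < n ∧ j < n then
      (if (M.entry ⟨i, h.2.1⟩ ⟨j, h.2.2⟩).isSome then 1 else 0)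
    else 0
  real a i j :=
    if h : a = 0 ∧ i < n ∧ j < n then (M.entry ⟨i, h.2.1⟩ ⟨j, h.2.2⟩).getD 0 else 0

/-- The cell with the kind of the answer: `0` is "no", `1` is "yes", and `2` announces an
instance that is stored as in `Encodes`. -/
def State.verdict (s : State) : ℕ := s.nat 3 0 0

end RealRAM

/-! Call two indices adjacent when their entry is specified. Excluding a `t`-block says that the
non-adjacency graph has no `K_{t,t}`, so by the Kővári–Sós–Turán bound a large vertex set contains a
vertex adjacent to nearly all of it. Repeatedly choosing a vertex of largest degree among the
remaining candidates therefore yields a large clique `K`, all of whose mutual distances are known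
(`NoBlock.greedy_step`, `run_clique`).

Affine dependences inside `K` can be read off the Cayley–Menger matrix. If the weights `e` sum to
zero, then `e` applied twice to the squared distances gives `-2‖∑ e i • p i‖²`. Hence a column
dependence on the rows in `K` forces `∑ e i • p i = 0` in every realization, and it must then hold
also on the row of any point `u` adjacent to its support (`RealizableOn.dep_insert`). The matrix has
rank at most `d + 2` (`RealizableOn.finrank_le`). A violation of either condition proves a
no-instance.

A point `v` of `K` is redundant if, for every neighbour `u` of `v`, column `v` depends on the
columns of the other neighbours of `u` in `K`, on the rows in `K` and `u`. Such a point can be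
deleted: its position is recovered from the rest of `K`, and all its specified distances then come
out right (`RealizableOn.of_erase`). If no violation is found and no point is redundant, every `v`
in `K` has a neighbour `u` for which `v` is a coloop of the neighbours of `u` in `K`. In rank at
most `d + 2` and without blocks this bounds `K` (`NoBlock.card_le_of_coloops`), hence the whole
vertex set, since a larger one would have given a larger clique.

The algorithm makes `n` rounds of clique search and deletion. Spans and ranks are found by
Gram–Schmidt without normalization, which uses only field operations and exact comparisons with
zero. -/

namespace RealRAM

/-! ### Structured programs, their semantics and their running time. -/

open Polynomial

/-- Structured programs: the only loops are `forN c a p`, which runs `p` with the counter in cell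
`(0, 0)` of the `a`-th array going through the numbers below `n + c`, where `n` is the content of
cell `(0, 0)` of array `0`. -/
inductive Code where
  | skip
  | setN (a : ℕ) (i j : NatExpr) (e : NatExpr)
  | setR (a : ℕ) (i j : NatExpr) (e : RealExpr)
  | seq (p q : Code)
  | ite (c : Cond) (p q : Code)
  | forN (c a : ℕ) (p : Code)

namespace Code

/-- The scalar variable stored in the `a`-th array of natural numbers. -/
abbrev var (a : ℕ) : NatExpr := .cell a (.const 0) (.const 0)

def toProg : Code → Prog
  | skip => .skip
  | setN a i j e => .setNat a i j e
  | setR a i j e => .setReal a i j e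
  | seq p q => .seq p.toProg q.toProg
  | ite c p q => .ite c p.toProg q.toProg
  | forN c a p => .seq (.setNat a (.const 0) (.const 0) (.const 0))
      (.loop (.natLE (.add (var a) (.const 1)) (.add (var 0) (.const c)))
        (.seq p.toProg (.setNat a (.const 0) (.const 0) (.add (var a) (.const 1)))))

/-- The states that a counting loop with body `f` and counter `a` passes through. -/
def iter (a : ℕ) (f : State → State) (s : State) : ℕ → State
  | 0 => s.setNat a 0 0 0
  | i + 1 => (f (iter a f s i)).setNat a 0 0 (i + 1)

open Classical in
/-- The state in which a structured program halts. -/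
noncomputable def run : Code → State → State
  | skip, s => s
  | setN a i j e, s => s.setNat a (i.eval s) (j.eval s) (e.eval s)
  | setR a i j e, s => s.setReal a (i.eval s) (j.eval s) (e.eval s)
  | seq p q, s => q.run (p.run s)
  | ite c p q, s => if c.Holds s then p.run s else q.run s
  | forN c a p, s => iter a p.run s (s.nat 0 0 0 + c)

/-- The arrays of natural numbers that a program may change. -/
def natWrites : Code → List ℕ
  | skip => []
  | setN a _ _ _ => [a]
  | setR _ _ _ _ => []
  | seq p q => p.natWrites ++ q.natWrites
  | ite _ p q => p.natWrites ++ q.natWrites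
  | forN _ a p => a :: p.natWrites

/-- The arrays of real numbers that a program may change. -/
def realWrites : Code → List ℕ
  | skip => []
  | setN _ _ _ _ => []
  | setR a _ _ _ => [a]
  | seq p q => p.realWrites ++ q.realWrites
  | ite _ p q => p.realWrites ++ q.realWrites
  | forN _ _ p => p.realWrites

/-- Loop bodies change neither the counter nor the bound, and the bound is changed only by the
last command. -/
def WF : Code → Prop
  | skip => True
  | setN _ _ _ _ => True
  | setR _ _ _ _ => True
  | seq p q => p.WF ∧ q.WF ∧ 0 ∉ p.natWrites
  | ite _ p q => p.WF ∧ q.WF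
  | forN _ a p => p.WF ∧ 0 ∉ a :: p.natWrites ∧ a ∉ p.natWrites

/-- A bound on the running time, as a polynomial in the content of cell `(0, 0)` of array `0`. -/
noncomputable def time : Code → ℕ[X]
  | skip => 1
  | setN _ i j e => C (i.cost + j.cost + e.cost + 1)
  | setR _ i j e => C (i.cost + j.cost + e.cost + 1)
  | seq p q => p.time + q.time
  | ite c p q => C (c.cost + 1) + p.time + q.time
  | forN c _ p => (X + C c) * (p.time + C 30) + C 30

/-- Frame rule. The write lists are computed syntactically, so its side condition can be settled by
`decide` for every concrete program. -/
theorem run_nat (p : Code) (s : State) {a : ℕ} (h : a ∉ p.natWrites) :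
    (p.run s).nat a = s.nat a := by
  induction p generalizing s with
  | skip => rfl
  | setN b i j e =>
    simp only [natWrites, List.mem_singleton] at h
    funext i j
    simp [run, State.setNat, h]
  | setR b i j e => rfl
  | seq p q hp hq =>
    simp only [natWrites, List.mem_append, not_or] at h
    rw [run, hq _ h.2, hp _ h.1]
  | ite c p q hp hq =>
    simp only [natWrites, List.mem_append, not_or] at h
    rw [run]
    split_ifs
    exacts [hp _ h.1, hq _ h.2]
  | forN c b p hp =>
    simp only [natWrites, List.mem_cons, not_or] at h
    have key : ∀ i, (iter b p.run s i).nat a = s.nat a := by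
      intro i
      induction i with
      | zero => funext i j; simp [iter, State.setNat, h.1]
      | succ i ih => funext i' j'; simp [iter, State.setNat, h.1, hp _ h.2, ih]
    exact key _

theorem run_real (p : Code) (s : State) {a : ℕ} (h : a ∉ p.realWrites) :
    (p.run s).real a = s.real a := by
  induction p generalizing s with
  | skip => rfl
  | setR b i j e =>
    simp only [realWrites, List.mem_singleton] at h
    funext i j
    simp [run, State.setReal, h]
  | setN b i j e => rfl
  | seq p q hp hq =>
    simp only [realWrites, List.mem_append, not_or] at h
    rw [run, hq _ h.2, hp _ h.1]
  | ite c p q hp hq =>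
    simp only [realWrites, List.mem_append, not_or] at h
    rw [run]
    split_ifs
    exacts [hp _ h.1, hq _ h.2]
  | forN c b p hp =>
    simp only [realWrites] at h
    have key : ∀ i, (iter b p.run s i).real a = s.real a := by
      intro i
      induction i with
      | zero => rfl
      | succ i ih => simp [iter, State.setNat, hp _ h, ih]
    exact key _

theorem iter_nat {a : ℕ} {p : Code} {s : State} {b : ℕ} (h : b ∉ a :: p.natWrites) (i : ℕ) :
    (iter a p.run s i).nat b = s.nat b := by
  simp only [List.mem_cons, not_or] at h
  induction i with
  | zero => funext i j; simp [iter, State.setNat, h.1]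
  | succ i ih => funext i' j'; simp [iter, State.setNat, h.1, run_nat _ _ h.2, ih]

theorem iter_real {a : ℕ} {p : Code} {s : State} {b : ℕ} (h : b ∉ p.realWrites) (i : ℕ) :
    (iter a p.run s i).real b = s.real b := by
  induction i with
  | zero => rfl
  | succ i ih => simp [iter, State.setNat, run_real _ _ h, ih]

theorem iter_counter (a : ℕ) (f : State → State) (s : State) (i : ℕ) :
    (iter a f s i).nat a 0 0 = i := by
  cases i <;> simp [iter, State.setNat]

theorem exec_loop (c a : ℕ) (p : Code) (s : State) (T N : ℕ)
    (hp : ∀ i, i < N → ∃ k, Exec p.toProg (iter a p.run s i) (p.run (iter a p.run s i)) k ∧ k ≤ T)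
    (hN : N = s.nat 0 0 0 + c) (h0 : 0 ∉ a :: p.natWrites) (ha : a ∉ p.natWrites) :
    ∀ j i, i + j = N →
      ∃ k, Exec (.loop (.natLE (.add (var a) (.const 1)) (.add (var 0) (.const c)))
        (.seq p.toProg (.setNat a (.const 0) (.const 0) (.add (var a) (.const 1)))))
        (iter a p.run s i) (iter a p.run s N) k ∧ k ≤ j * (T + 30) + 12 := by
  intro j
  induction j with
  | zero =>
    -- The failing test alone costs 12. A passing test and the increment of the counter cost 20
    -- together, within the allowance of 30.
    intro i hi
    obtain rfl : i = N := by omega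
    refine ⟨_, .loop_false ?_, ?_⟩
    · simp [Cond.Holds, NatExpr.eval, iter_counter, iter_nat h0, hN]
    · simp [Cond.cost, NatExpr.cost]
  | succ j ih =>
    intro i hi
    obtain ⟨k, hk, hkT⟩ := hp i (by omega)
    obtain ⟨l, hl, hlT⟩ := ih (i + 1) (by omega)
    refine ⟨_, .loop_true ?_ (.seq hk (.setNat _ _ _ _ _)) (s'' := iter a p.run s N) (l := l) ?_, ?_⟩
    · simp only [Cond.Holds, NatExpr.eval, iter_counter, iter_nat h0]
      omega
    · have : (p.run (iter a p.run s i)).nat a 0 0 = i := by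
        rw [run_nat _ _ ha, iter_counter]
      simpa [NatExpr.eval, this, iter] using hl
    · simp only [Cond.cost, NatExpr.cost]
      rw [Nat.succ_mul]
      omega

/-- A well-formed structured program halts in time polynomial in `n`. -/
theorem exec_run (p : Code) (hp : p.WF) (s : State) :
    ∃ k, Exec p.toProg s (p.run s) k ∧ k ≤ p.time.eval (s.nat 0 0 0) := by
  induction p generalizing s with
  | skip => exact ⟨_, .skip s, by simp [time]⟩
  | setN a i j e => exact ⟨_, .setNat s a i j e, by simp [time]⟩
  | setR a i j e => exact ⟨_, .setReal s a i j e, by simp [time]⟩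
  | seq p q ihp ihq =>
    obtain ⟨h1, h2, h3⟩ := hp
    obtain ⟨k, hk, hk'⟩ := ihp h1 s
    obtain ⟨l, hl, hl'⟩ := ihq h2 (p.run s)
    rw [run_nat _ _ h3] at hl'
    refine ⟨_, .seq hk hl, ?_⟩
    simp only [time, eval_add]
    omega
  | ite c p q ihp ihq =>
    obtain ⟨h1, h2⟩ := hp
    by_cases h : c.Holds s
    · obtain ⟨k, hk, hk'⟩ := ihp h1 s
      refine ⟨_, by simpa only [toProg, run, h, if_true] using Exec.ite_true h hk, ?_⟩
      simp only [time, eval_add, eval_C]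
      omega
    · obtain ⟨k, hk, hk'⟩ := ihq h2 s
      refine ⟨_, by simpa only [toProg, run, h, if_false] using Exec.ite_false h hk, ?_⟩
      simp only [time, eval_add, eval_C]
      omega
  | forN c a p ih =>
    obtain ⟨h1, h2, h3⟩ := hp
    obtain ⟨k, hk, hk'⟩ := exec_loop c a p s (p.time.eval (s.nat 0 0 0)) (s.nat 0 0 0 + c)
      (fun i _ => by simpa only [iter_nat h2] using ih h1 (iter a p.run s i)) rfl h2 h3
      (s.nat 0 0 0 + c) 0 (by omega)
    refine ⟨_, .seq (.setNat _ _ _ _ _) hk, ?_⟩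
    simp only [time, eval_add, eval_mul, eval_C, eval_X, NatExpr.cost]
    omega

/-- Proof by loop invariant. -/
theorem forN_induction {c a : ℕ} {p : Code} {s : State} (I : ℕ → State → Prop)
    (h0 : I 0 (s.setNat a 0 0 0))
    (hs : ∀ i s', i < s.nat 0 0 0 + c → s'.nat a 0 0 = i →
      (∀ b, b ∉ a :: p.natWrites → s'.nat b = s.nat b) →
      (∀ b, b ∉ p.realWrites → s'.real b = s.real b) → I i s' →
      I (i + 1) ((p.run s').setNat a 0 0 (i + 1))) :
    I (s.nat 0 0 0 + c) ((forN c a p).run s) := by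
  have key : ∀ i, i ≤ s.nat 0 0 0 + c → I i (iter a p.run s i) := by
    intro i
    induction i with
    | zero => exact fun _ => h0
    | succ i ih =>
      exact fun hi => hs i _ (by omega) (iter_counter _ _ _ _) (fun b hb => iter_nat hb i)
        (fun b hb => iter_real hb i) (ih (by omega))
  exact key _ le_rfl

end Code

end RealRAM

/-! ### Extremal combinatorics of block-free adjacency. -/

open Finset in
/-- The Kővári–Sós–Turán bound. -/
theorem card_le_of_no_biclique {V : Type*} (R : V → V → Prop) [DecidableRel R] (U Y : Finset V)
    (t c : ℕ) (hY : Y.Nonempty)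
    (hdeg : ∀ u ∈ U, #Y ≤ c * (#{y ∈ Y | R u y} + 1 - t))
    (hno : ∀ I ⊆ U, ∀ J ⊆ Y, #I = t → #J = t → ∃ i ∈ I, ∃ j ∈ J, ¬ R i j) :
    #U ≤ t * c ^ t := by
  classical
  -- Double count of the pairs of a `u` and a `t`-set `J` of points related to it: a `J` occurring
  -- `t` times would give a biclique.
  have h1 : ∑ u ∈ U, (#{y ∈ Y | R u y}).choose t ≤ t * (#Y).choose t := by
    have h := sum_card_bipartiteAbove_eq_sum_card_bipartiteBelow
      (s := U) (t := Y.powersetCard t) (fun u J => ∀ j ∈ J, R u j)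
    have h2 : ∀ u ∈ U, #((Y.powersetCard t).bipartiteAbove (fun u J => ∀ j ∈ J, R u j) u) =
        (#{y ∈ Y | R u y}).choose t := by
      intro u _
      rw [← card_powersetCard]
      congr 1
      ext J
      simp only [mem_bipartiteAbove, mem_powersetCard, subset_iff, mem_filter]
      grind
    rw [← sum_congr rfl h2, h, ← card_powersetCard, mul_comm, ← smul_eq_mul]
    refine sum_le_card_nsmul _ _ _ fun J hJ => ?_
    by_contra! hlt
    obtain ⟨I, hI, hIt⟩ := exists_subset_card_eq hlt.le
    rw [mem_powersetCard] at hJ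
    obtain ⟨i, hi, j, hj, hij⟩ := hno I (hI.trans (filter_subset _ _)) J hJ.1 hIt hJ.2
    exact hij ((mem_filter.1 (hI hi)).2 j hj)
  have hpos : 0 < #Y ^ t := pow_pos hY.card_pos _
  refine Nat.le_of_mul_le_mul_right (c := #Y ^ t) ?_ hpos
  calc #U * #Y ^ t = ∑ u ∈ U, #Y ^ t := by simp
    _ ≤ ∑ u ∈ U, c ^ t * (t.factorial * (#{y ∈ Y | R u y}).choose t) := by
        -- The falling factorial of `x` of length `t` is at least `(x + 1 - t) ^ t`; this dictates
        -- the shape of `hdeg`.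
        refine sum_le_sum fun u hu => ?_
        rw [← Nat.descFactorial_eq_factorial_mul_choose]
        calc #Y ^ t ≤ (c * (#{y ∈ Y | R u y} + 1 - t)) ^ t := Nat.pow_le_pow_left (hdeg u hu) _
          _ = c ^ t * (#{y ∈ Y | R u y} + 1 - t) ^ t := mul_pow _ _ _
          _ ≤ _ := Nat.mul_le_mul_left _ (Nat.pow_sub_le_descFactorial _ _)
    _ = c ^ t * t.factorial * ∑ u ∈ U, (#{y ∈ Y | R u y}).choose t := by
        rw [mul_sum]; exact sum_congr rfl fun _ _ => by ring
    _ ≤ c ^ t * t.factorial * (t * (#Y).choose t) := Nat.mul_le_mul_left _ h1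
    _ = t * c ^ t * (t.factorial * (#Y).choose t) := by ring
    _ ≤ t * c ^ t * #Y ^ t := by
        rw [← Nat.descFactorial_eq_factorial_mul_choose]
        exact Nat.mul_le_mul_left _ (Nat.descFactorial_le_pow _ _)

/-- Any two sets of `t` vertices are joined by an edge, or have a common vertex with a loop. -/
def NoBlock {V : Type*} (adj : V → V → Prop) (t : ℕ) : Prop :=
  ∀ I J : Finset V, I.card = t → J.card = t → ∃ i ∈ I, ∃ j ∈ J, adj i j

-- Otherwise non-adjacency has density above `1 / (4 * L)` on `X × X`, and `card_le_of_no_biclique`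
-- bounds `X`. Taking `8 * L` instead of `4 * L` absorbs the loss of `t` in the degrees, because `8
-- * L * t ≤ #X`.
open Finset in
theorem NoBlock.exists_few_nonadj {V : Type*} {adj : V → V → Prop} [DecidableRel adj] {t : ℕ}
    (h : NoBlock adj t) (ht : 1 ≤ t) (X : Finset V) (L : ℕ) (hL : 1 ≤ L)
    (hX : t * (8 * L) ^ t < #X) : ∃ b ∈ X, 4 * L * #{y ∈ X | ¬ adj b y} ≤ #X := by
  by_contra! hcon
  have h8 : 8 * L * t ≤ #X := by
    have : 8 * L ≤ (8 * L) ^ t := Nat.le_self_pow (by omega) _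
    nlinarith
  have := card_le_of_no_biclique (fun a b => ¬ adj a b) X X t (8 * L)
    (card_pos.1 (by omega)) (fun u hu => ?_) (fun I _ J _ hI hJ => ?_)
  · omega
  · have h1 := hcon u hu
    rw [Nat.mul_sub]
    have : 8 * L * (#{y ∈ X | ¬ adj u y} + 1) = 2 * (4 * L * #{y ∈ X | ¬ adj u y}) + 8 * L := by
      ring
    omega
  · obtain ⟨i, hi, j, hj, hij⟩ := h I J hI hJ
    exact ⟨i, hi, j, hj, fun h => h hij⟩

open Finset Submodule Module in
/-- In a large set of vectors of bounded rank, some vector lies in the span of the other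
neighbours of each of its neighbours. -/
theorem NoBlock.card_le_of_coloops {V W : Type*} [AddCommGroup W] [Module ℝ W]
    [Module.Finite ℝ W] {adj : V → V → Prop} {t D : ℕ} (h : NoBlock adj t) (ht : 1 ≤ t)
    (hD : 1 ≤ D) (K : Finset V) (w : V → W) (w0 : W)
    (hrank : finrank ℝ (span ℝ (insert w0 (w '' K))) ≤ D)
    (hcol : ∀ v ∈ K, ∃ u, adj u v ∧ w v ∉ span ℝ (insert w0 (w '' {s | s ∈ K ∧ adj u s ∧ s ≠ v}))) :
    #K ≤ 2 * D * (t * (4 * D) ^ t) := by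
  classical
  by_cases hbig : #K < 4 * D * t
  · have : 4 * D ≤ (4 * D) ^ t := Nat.le_self_pow (by omega) _
    nlinarith [Nat.zero_le (D * (t * (4 * D) ^ t)), Nat.mul_le_mul_left (D * t) this]
  push Not at hbig
  have hKpos : 0 < #K := lt_of_lt_of_le (by positivity) hbig
  set rk : Finset V → ℕ := fun K' => finrank ℝ (span ℝ (insert w0 (w '' K'))) with hrk
  -- A deleted vector is priced `2 * D` and a unit of rank `#K`. As the rank is at most `D`, a
  -- minimizer deletes at most half of `K`, and lowering its rank further requires at least `#K / (2
  -- * D)` more deletions.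
  obtain ⟨K', hK', hmin⟩ := exists_min_image K.powerset
    (fun K' => 2 * D * #(K \ K') + #K * rk K') ⟨K, by simp⟩
  rw [mem_powerset] at hK'
  have hlost : 2 * #(K \ K') ≤ #K := by
    have h1 := hmin K (by simp)
    simp only [sdiff_self, bot_eq_empty, card_empty, mul_zero, zero_add] at h1
    have h2 : #K * rk K ≤ #K * D := Nat.mul_le_mul_left _ hrank
    have : D * (2 * #(K \ K')) ≤ D * #K := by nlinarith
    exact Nat.le_of_mul_le_mul_left this hD
  have hK'card : #(K \ K') + #K' = #K := card_sdiff_add_card_eq_card hK'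
  choose! u hu hspan using hcol
  -- Restricting `K'` to the span `F` of the neighbours of `u v` lowers the rank, since `w v` is not
  -- in `F`. So many vectors are lost, and apart from `v` they are all non-neighbours of `u v`.
  have hmiss : ∀ v ∈ K', #K ≤ 2 * D * (#{y ∈ K | ¬ adj (u v) y} + 1) := by
    intro v hv
    set F := span ℝ (insert w0 (w '' {s | s ∈ K ∧ adj (u v) s ∧ s ≠ v})) with hF
    set K'' := K'.filter (fun s => w s ∈ F) with hK''
    have hlt : rk K'' < rk K' := by
      apply finrank_lt_finrank_of_lt
      refine lt_of_le_of_ne (span_mono ?_) fun heq => ?_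
      · exact Set.insert_subset_insert (Set.image_mono (coe_subset.2 (filter_subset _ _)))
      · have hvK : w v ∈ span ℝ (insert w0 (w '' K')) :=
          subset_span (Set.mem_insert_of_mem _ ⟨v, hv, rfl⟩)
        rw [← heq] at hvK
        refine hspan v (hK' hv) ((span_le.2 ?_) hvK)
        rintro _ (rfl | ⟨s, hs, rfl⟩)
        · exact subset_span (Set.mem_insert _ _)
        · exact (mem_filter.1 hs).2
    have h1 := hmin K'' (mem_powerset.2 ((filter_subset _ _).trans hK'))
    have h2 : #(K \ K'') + #K'' = #K :=
      card_sdiff_add_card_eq_card ((filter_subset _ _).trans hK')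
    have h3 : #(K \ K'') = #(K \ K') + #(K' \ K'') := by
      have : #(K' \ K'') + #K'' = #K' := card_sdiff_add_card_eq_card (filter_subset _ _)
      omega
    have h4 : #K ≤ 2 * D * #(K' \ K'') := by
      have : #K * rk K'' + #K ≤ #K * rk K' := by
        calc #K * rk K'' + #K = #K * (rk K'' + 1) := by ring
          _ ≤ _ := Nat.mul_le_mul_left _ hlt
      simp only [h3] at h1
      nlinarith
    have h5 : K' \ K'' ⊆ insert v {y ∈ K | ¬ adj (u v) y} := by
      intro y hy
      simp only [hK'', mem_sdiff, mem_filter, not_and] at hy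
      simp only [mem_insert, mem_filter]
      by_contra! hcon
      exact hy.2 hy.1 (subset_span (Set.mem_insert_of_mem _
        ⟨y, ⟨hK' hy.1, hcon.2 (hK' hy.1), hcon.1⟩, rfl⟩))
    exact h4.trans (Nat.mul_le_mul_left _ ((card_le_card h5).trans (card_insert_le _ _)))
  -- The vectors with a common witness `a` are all adjacent to `a`, and none lies in the span of the
  -- others; being independent, they number at most `D`.
  have hfib : #K' ≤ D * #(K'.image u) := by
    refine card_le_mul_card_image _ _ fun a _ => ?_
    have hli : LinearIndependent ℝ (fun v : {v ∈ K' | u v = a} => w v) := by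
      rw [linearIndependent_iff_notMem_span]
      rintro ⟨v, hv⟩ hmem
      obtain ⟨hvK, hva⟩ := mem_filter.1 hv
      refine hspan v (hK' hvK) (span_mono ?_ hmem)
      rintro _ ⟨⟨s, hs⟩, hsv, rfl⟩
      obtain ⟨hsK, hsa⟩ := mem_filter.1 hs
      refine Set.mem_insert_of_mem _ ⟨s, ⟨hK' hsK, ?_, ?_⟩, rfl⟩
      · rw [hva, ← hsa]; exact hu s (hK' hsK)
      · rintro rfl; simp at hsv
    have h1 := finrank_span_eq_card hli
    rw [Fintype.card_coe] at h1
    rw [← h1]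
    refine le_trans (finrank_mono (span_mono ?_)) hrank
    rintro _ ⟨⟨s, hs⟩, rfl⟩
    exact Set.mem_insert_of_mem _ ⟨s, hK' (mem_filter.1 hs).1, rfl⟩
  -- The witnesses have many non-neighbours in `K`, so there are few of them.
  have hU := card_le_of_no_biclique (fun a b => ¬ adj a b) (K'.image u) K t (4 * D)
    (card_pos.1 hKpos) (fun a ha => ?_) (fun I _ J _ hI hJ => ?_)
  · have := Nat.mul_le_mul_left (2 * D) hU
    have h2 : 2 * D * #(K'.image u) = 2 * (D * #(K'.image u)) := by ring
    omega
  · obtain ⟨v, hv, rfl⟩ := mem_image.1 ha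
    have h1 := hmiss v hv
    rw [Nat.mul_sub]
    have : 4 * D * (#{y ∈ K | ¬ adj (u v) y} + 1) = 2 * (2 * D * (#{y ∈ K | ¬ adj (u v) y} + 1)) := by
      ring
    omega
  · obtain ⟨i, hi, j, hj, hij⟩ := h I J hI hJ
    exact ⟨i, hi, j, hj, fun h => h hij⟩

/-- The numerical form of the bound on the number of rows. -/
theorem compression_bound {m d t : ℕ} (hd : 1 ≤ d) (ht : 1 ≤ t)
    (h : m ≤ 2 * t * (8 * (2 * (d + 2) * (t * (4 * (d + 2)) ^ t) + 1)) ^ t) :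
    m ≤ (d + 1) ^ (20 * t ^ 2) := by
  -- From `d ≥ 1` comes `q ≥ 2`, so numerical constants and `t` itself are absorbed into powers of
  -- `q`.
  set q := d + 1 with hq
  have hq2 : 2 ≤ q := by omega
  have h2 : ∀ k, 2 ^ k ≤ q ^ k := fun k => Nat.pow_le_pow_left hq2 k
  have hDq : d + 2 ≤ q ^ 2 := by nlinarith
  have ht' : t ≤ q ^ t := Nat.lt_two_pow_self.le.trans (h2 t)
  have h4 : 4 * (d + 2) ≤ q ^ 4 := by
    calc 4 * (d + 2) ≤ q ^ 2 * q ^ 2 := Nat.mul_le_mul (h2 2) hDq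
      _ = q ^ 4 := by ring
  have hin : 8 * (2 * (d + 2) * (t * (4 * (d + 2)) ^ t) + 1) ≤ q ^ (12 * t) := by
    have h5 : t * (4 * (d + 2)) ^ t ≤ q ^ (5 * t) := by
      calc t * (4 * (d + 2)) ^ t ≤ q ^ t * (q ^ 4) ^ t :=
            Nat.mul_le_mul ht' (Nat.pow_le_pow_left h4 t)
        _ = q ^ (5 * t) := by rw [← pow_mul, ← pow_add]; ring_nf
    have h6 : 1 ≤ q ^ (5 * t) := Nat.one_le_pow _ _ (by omega)
    calc 8 * (2 * (d + 2) * (t * (4 * (d + 2)) ^ t) + 1)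
        ≤ 8 * (2 * q ^ 2 * q ^ (5 * t) + q ^ 2 * q ^ (5 * t)) := by
          have := Nat.mul_le_mul (Nat.mul_le_mul_left 2 hDq) h5
          have h7 : 1 ≤ q ^ 2 * q ^ (5 * t) := Nat.mul_pos (by positivity) h6
          omega
      _ ≤ 2 ^ 5 * q ^ 2 * q ^ (5 * t) := by nlinarith [Nat.zero_le (q ^ 2 * q ^ (5 * t))]
      _ ≤ q ^ 5 * q ^ 2 * q ^ (5 * t) := by gcongr
      _ = q ^ (7 + 5 * t) := by rw [← pow_add, ← pow_add]
      _ ≤ q ^ (12 * t) := Nat.pow_le_pow_right (by omega) (by omega)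
  calc m ≤ _ := h
    _ ≤ q * q ^ t * (q ^ (12 * t)) ^ t := by gcongr
    _ = q ^ (1 + t + 12 * t * t) := by rw [← pow_mul, pow_add, pow_add, pow_one]
    _ ≤ q ^ (20 * t ^ 2) := Nat.pow_le_pow_right (by omega) (by nlinarith)

/-! ### Realizations and the Cayley–Menger matrix. -/

namespace PartialMatrix

variable {n : ℕ} (M : PartialMatrix n)

/-- The entry `(i, j)` is specified. -/
def Adj (i j : Fin n) : Prop := (M.entry i j).isSome = true

instance : DecidableRel M.Adj := fun _ _ => inferInstanceAs (Decidable (_ = true))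

/-- The entries, with `0` in place of the unspecified ones. -/
def val (i j : Fin n) : ℝ := (M.entry i j).getD 0

theorem Adj.symm {M : PartialMatrix n} {i j : Fin n} (h : M.Adj i j) : M.Adj j i := by
  rwa [Adj, M.symm]

theorem adj_self (i : Fin n) : M.Adj i i := by simp [Adj, M.diag]

theorem val_symm (i j : Fin n) : M.val i j = M.val j i := by rw [val, M.symm, val]

theorem val_self (i : Fin n) : M.val i i = 0 := by simp [val, M.diag]

/-- The submatrix on `A` is a yes-instance. -/
def RealizableOn (d : ℕ) (A : Finset (Fin n)) : Prop :=
  ∃ p : Fin n → EuclideanSpace ℝ (Fin d),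
    ∀ i ∈ A, ∀ j ∈ A, M.Adj i j → M.val i j = ‖p i - p j‖ ^ 2

theorem entry_eq_some_iff {i j : Fin n} {x : ℝ} :
    M.entry i j = some x ↔ M.Adj i j ∧ M.val i j = x := by
  unfold Adj val
  cases M.entry i j <;> simp

theorem completable_iff (d : ℕ) : M.Completable d ↔ M.RealizableOn d Finset.univ := by
  constructor
  · rintro ⟨D, ⟨p, hp⟩, hD⟩
    exact ⟨p, fun i _ j _ h => by rw [← hp, hD i j _ (M.entry_eq_some_iff.2 ⟨h, rfl⟩)]⟩
  · rintro ⟨p, hp⟩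
    refine ⟨fun i j => ‖p i - p j‖ ^ 2, ⟨p, fun _ _ => rfl⟩, fun i j x h => ?_⟩
    obtain ⟨h1, rfl⟩ := M.entry_eq_some_iff.1 h
    exact (hp i (Finset.mem_univ _) j (Finset.mem_univ _) h1).symm

theorem completable_principal_iff {m : ℕ} (f : Fin m ↪o Fin n) (A : Finset (Fin n))
    (hf : ∀ a, a ∈ A ↔ ∃ i, f i = a) (d : ℕ) :
    (M.principal f).Completable d ↔ M.RealizableOn d A := by
  rw [completable_iff]
  constructor
  · rintro ⟨p, hp⟩
    refine ⟨fun a => if h : ∃ i, f i = a then p h.choose else 0, fun a ha b hb hab => ?_⟩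
    obtain ⟨i, rfl⟩ := (hf a).1 ha
    obtain ⟨j, rfl⟩ := (hf b).1 hb
    have key : ∀ i, (if h : ∃ k, f k = f i then p h.choose else 0) = p i := by
      intro i
      have h : ∃ k, f k = f i := ⟨i, rfl⟩
      rw [dif_pos h, f.injective h.choose_spec]
    simp only [key]
    exact hp i (Finset.mem_univ _) j (Finset.mem_univ _) hab
  · rintro ⟨p, hp⟩
    exact ⟨fun i => p (f i), fun i _ j _ h =>
      hp _ ((hf _).2 ⟨i, rfl⟩) _ ((hf _).2 ⟨j, rfl⟩) h⟩

/-- Disjointness can be dropped because the diagonal is specified: a common index is adjacent to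
itself. -/
theorem ExcludesBlock.noBlock {M : PartialMatrix n} {t : ℕ} (h : M.ExcludesBlock t) :
    NoBlock M.Adj t := by
  intro I J hI hJ
  by_contra! hcon
  refine h ⟨I, J, Finset.disjoint_left.2 fun i hi hj => hcon i hi i hj (M.adj_self i), hI, hJ,
    fun i hi j hj => ?_⟩
  simpa [Adj] using hcon i hi j hj

/-- Column `i` of the Cayley–Menger matrix, restricted to the rows in `C` and the last one. -/
noncomputable def col (C : Finset (Fin n)) (i : Fin n) : EuclideanSpace ℝ (Fin (n + 1)) :=
  WithLp.toLp 2 (Fin.snoc (α := fun _ => ℝ) (fun k => if k ∈ C then M.val k i else 0) 1)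

/-- The last column of the Cayley–Menger matrix, restricted to the rows in `C` and the last one. -/
noncomputable def ones (C : Finset (Fin n)) : EuclideanSpace ℝ (Fin (n + 1)) :=
  WithLp.toLp 2 (Fin.snoc (α := fun _ => ℝ) (fun k => if k ∈ C then 1 else 0) 0)

/-- Column `v` is a combination of the last column and the columns in `S`, on the rows in `C` and
the last one. -/
def Dep (C S : Finset (Fin n)) (v : Fin n) : Prop :=
  M.col C v ∈ Submodule.span ℝ (insert (ones C) (M.col C '' S))

variable {M}

/-- `e` consists of the negated coefficients together with a `1` at `v`, and `c` is the coefficient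
of the border column. The last coordinate becomes `∑ i, e i = 0`, the condition under which squared
distances behave linearly. -/
theorem dep_iff {C S : Finset (Fin n)} {v : Fin n} (hv : v ∉ S) :
    M.Dep C S v ↔ ∃ (e : Fin n → ℝ) (c : ℝ), (∀ i, i ∉ S → i ≠ v → e i = 0) ∧ e v = 1 ∧
      ∑ i, e i = 0 ∧ ∀ k ∈ C, ∑ i, e i * M.val k i = c := by
  classical
  have hsum : ∀ (e g : Fin n → ℝ), (∀ i, i ∉ S → i ≠ v → e i = 0) → e v = 1 →
      ∑ i, e i * g i = g v + ∑ i ∈ S, e i * g i := by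
    intro e g h1 h2
    rw [← Finset.sum_subset (Finset.subset_univ (insert v S)), Finset.sum_insert hv, h2, one_mul]
    intro i _ hi
    rw [Finset.mem_insert, not_or] at hi
    rw [h1 i hi.2 hi.1, zero_mul]
  unfold Dep
  rw [Submodule.mem_span_insert]
  constructor
  · rintro ⟨a, z, hz, h⟩
    obtain ⟨f, rfl⟩ := Submodule.mem_span_image_finset_iff_exists_fun' ℝ |>.1 hz
    have hcoord : ∀ k, M.col C v k = a * ones C k + ∑ i ∈ S, f i * M.col C i k := by
      intro k
      rw [h]
      simp
    set e : Fin n → ℝ := fun i => if i = v then 1 else if i ∈ S then - f i else 0 with he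
    have he1 : ∀ i, i ∉ S → i ≠ v → e i = 0 := fun i h1 h2 => by simp [he, h1, h2]
    have he2 : e v = 1 := by simp [he]
    have he3 : ∀ i ∈ S, e i = - f i := fun i hi => by
      have : i ≠ v := by rintro rfl; exact hv hi
      simp [he, hi, this]
    refine ⟨e, a, he1, he2, ?_, fun k hk => ?_⟩
    · have h1 := hsum e (fun _ => 1) he1 he2
      have h2 := hcoord (Fin.last n)
      simp only [col, ones, Fin.snoc_last, mul_one, mul_zero, zero_add] at h1 h2
      rw [h1, Finset.sum_congr rfl he3, h2, Finset.sum_neg_distrib, add_neg_cancel]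
    · have h1 := hsum e (fun i => M.val k i) he1 he2
      have h2 := hcoord k.castSucc
      simp only [col, ones, Fin.snoc_castSucc, hk, if_true, mul_one] at h2
      rw [h1, Finset.sum_congr rfl (fun i hi => by rw [he3 i hi, neg_mul]),
        Finset.sum_neg_distrib, h2, add_neg_cancel_right]
  · rintro ⟨e, c, he1, he2, h0, hC⟩
    refine ⟨c, ∑ i ∈ S, (- e i) • M.col C i,
      Submodule.sum_mem _ fun i hi => Submodule.smul_mem _ _
        (Submodule.subset_span ⟨i, hi, rfl⟩), ?_⟩
    ext k
    simp only [PiLp.add_apply, PiLp.smul_apply, smul_eq_mul, WithLp.ofLp_sum, Finset.sum_apply,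
      WithLp.ofLp_smul, Pi.smul_apply, neg_mul, Finset.sum_neg_distrib, col, ones]
    refine Fin.lastCases ?_ (fun k => ?_) k
    · have h1 := hsum e (fun _ => 1) he1 he2
      simp only [mul_one] at h1
      simp only [Fin.snoc_last, mul_one, mul_zero, zero_add]
      linarith
    · simp only [Fin.snoc_castSucc]
      by_cases hk : k ∈ C
      · have h1 := hsum e (fun i => M.val k i) he1 he2
        have h2 := hC k hk
        simp only [hk, if_true, mul_one]
        linarith
      · simp [hk]

section Geometry

variable {ι E : Type*} [Fintype ι] [NormedAddCommGroup E] [InnerProductSpace ℝ E]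

/-- The terms `‖q‖ ^ 2` cancel, which leaves an affine function of `q` with gradient `-2 • ∑ i, e i
• p i`. -/
theorem sum_mul_dist_sq (e : ι → ℝ) (p : ι → E) (h0 : ∑ i, e i = 0) (q : E) :
    ∑ i, e i * ‖q - p i‖ ^ 2 = ∑ i, e i * ‖p i‖ ^ 2 - 2 * inner ℝ q (∑ i, e i • p i) := by
  have h : ∀ i, e i * ‖q - p i‖ ^ 2 =
      e i * ‖q‖ ^ 2 - 2 * inner ℝ q (e i • p i) + e i * ‖p i‖ ^ 2 := by
    intro i
    rw [norm_sub_sq_real, inner_smul_right]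
    ring
  rw [Finset.sum_congr rfl fun i _ => h i, Finset.sum_add_distrib, Finset.sum_sub_distrib,
    ← Finset.sum_mul, h0, inner_sum, Finset.mul_sum]
  ring

/-- Schoenberg's identity: the quadratic form of the squared distances at `e` equals `-2 * ‖∑ i, e i
• p i‖ ^ 2`. -/
theorem sum_smul_eq_zero (e : ι → ℝ) (p : ι → E) (h0 : ∑ i, e i = 0)
    (h : ∑ k, e k * ∑ i, e i * ‖p k - p i‖ ^ 2 = 0) : ∑ i, e i • p i = 0 := by
  have h1 : ∀ k, e k * ∑ i, e i * ‖p k - p i‖ ^ 2 =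
      e k * ∑ i, e i * ‖p i‖ ^ 2 - 2 * inner ℝ (e k • p k) (∑ i, e i • p i) := by
    intro k
    rw [sum_mul_dist_sq e p h0, real_inner_smul_left]
    ring
  rw [Finset.sum_congr rfl fun k _ => h1 k, Finset.sum_sub_distrib, ← Finset.sum_mul, h0, zero_mul,
    ← Finset.mul_sum, ← sum_inner, zero_sub, neg_eq_zero, real_inner_self_eq_norm_sq] at h
  simpa using h

end Geometry

/-- In a realizable instance, a dependence between points of a clique is compatible with the
distances to any further point. -/
theorem RealizableOn.dep_insert {d : ℕ} {A K S : Finset (Fin n)} {u v : Fin n}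
    (hA : M.RealizableOn d A) (hKA : K ⊆ A) (hK : ∀ i ∈ K, ∀ j ∈ K, M.Adj i j)
    (hu : u ∈ A) (hv : v ∈ K) (huv : M.Adj u v) (hS : S ⊆ K) (huS : ∀ s ∈ S, M.Adj u s)
    (hvS : v ∉ S) (h : M.Dep K S v) : M.Dep (insert u K) S v := by
  classical
  obtain ⟨p, hp⟩ := hA
  rw [dep_iff hvS] at h ⊢
  obtain ⟨e, c, h1, h2, h0, hc⟩ := h
  refine ⟨e, c, h1, h2, h0, ?_⟩
  have hsupp : ∀ i, e i ≠ 0 → i ∈ S ∨ i = v := fun i hi => by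
    by_contra! hcon
    exact hi (h1 i hcon.1 hcon.2)
  have hsuppK : ∀ i, e i ≠ 0 → i ∈ K := fun i hi => by
    rcases hsupp i hi with h | rfl
    exacts [hS h, hv]
  have hdist : ∀ k ∈ A, (∀ i, e i ≠ 0 → M.Adj k i) →
      ∑ i, e i * M.val k i = ∑ i, e i * ‖p k - p i‖ ^ 2 := by
    intro k hk hki
    refine Finset.sum_congr rfl fun i _ => ?_
    by_cases hi : e i = 0
    · simp [hi]
    · rw [hp k hk i (hKA (hsuppK i hi)) (hki i hi)]
  have hKd : ∀ k ∈ K, ∑ i, e i * ‖p k - p i‖ ^ 2 = c := fun k hk => by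
    rw [← hdist k (hKA hk) fun i hi => hK k hk i (hsuppK i hi), hc k hk]
  -- On the support of `e` every row gives the same value `c`, so the quadratic form is `c` times
  -- the vanishing sum of `e`.
  have hP : ∑ i, e i • p i = 0 := by
    refine sum_smul_eq_zero e p h0 ?_
    calc ∑ k, e k * ∑ i, e i * ‖p k - p i‖ ^ 2 = ∑ k, e k * c := by
          refine Finset.sum_congr rfl fun k _ => ?_
          by_cases hk : e k = 0
          · simp [hk]
          · rw [hKd k (hsuppK k hk)]
      _ = 0 := by rw [← Finset.sum_mul, h0, zero_mul]
  intro k hk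
  rcases Finset.mem_insert.1 hk with rfl | hk
  -- With zero gradient, the weighted sum of squared distances takes the same value at the new point
  -- as at `v`.
  · rw [hdist k hu, sum_mul_dist_sq e p h0, ← hKd v hv, sum_mul_dist_sq e p h0, hP]
    · simp
    · intro i hi
      rcases hsupp i hi with h | rfl
      exacts [huS i h, huv]
  · exact hc k hk

theorem Dep.mono {C C' S : Finset (Fin n)} {v : Fin n} (hC : C ⊆ C') (hv : v ∉ S)
    (h : M.Dep C' S v) : M.Dep C S v := by
  rw [dep_iff hv] at h ⊢
  obtain ⟨e, c, h1, h2, h0, hc⟩ := h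
  exact ⟨e, c, h1, h2, h0, fun k hk => hc k (hC hk)⟩

/-- A point whose position and distances are determined by the rest can be deleted. -/
theorem RealizableOn.of_erase {d : ℕ} {A K : Finset (Fin n)} {v : Fin n}
    (hKA : K ⊆ A) (hK : ∀ i ∈ K, ∀ j ∈ K, M.Adj i j) (hv : v ∈ K)
    (hdep : ∀ u ∈ A, M.Adj u v → M.Dep (insert u K) {s ∈ K | M.Adj u s ∧ s ≠ v} v)
    (h : M.RealizableOn d (A.erase v)) : M.RealizableOn d A := by
  obtain ⟨p, hp⟩ := h
  simp_rw [dep_iff (show v ∉ {s ∈ K | M.Adj _ s ∧ s ≠ v} by simp)] at hdep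
  -- The case `u = v` of the hypothesis provides the affine combination at which `v` is placed.
  obtain ⟨e₀, c₀, h₀1, h₀2, h₀0, h₀c⟩ := hdep v (hKA hv) (M.adj_self v)
  set q : Fin n → EuclideanSpace ℝ (Fin d) :=
    Function.update p v (- ∑ i ∈ Finset.univ.erase v, e₀ i • p i) with hq
  have hqp : ∀ i, i ≠ v → q i = p i := fun i hi => by simp [hq, hi]
  have hq0 : ∑ i, e₀ i • q i = 0 := by
    rw [← Finset.add_sum_erase _ _ (Finset.mem_univ v), h₀2, one_smul,
      Finset.sum_congr rfl (fun i hi => by rw [hqp i (Finset.ne_of_mem_erase hi)])]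
    simp [hq]
  have hqd : ∀ i ∈ A, ∀ j ∈ A, i ≠ v → j ≠ v → M.Adj i j → M.val i j = ‖q i - q j‖ ^ 2 := by
    intro i hi j hj hiv hjv hij
    rw [hqp i hiv, hqp j hjv, hp i (Finset.mem_erase.2 ⟨hiv, hi⟩) j (Finset.mem_erase.2 ⟨hjv, hj⟩)
      hij]
  have hsuppK : ∀ (u : Fin n) (e : Fin n → ℝ),
      (∀ i, i ∉ ({s ∈ K | M.Adj u s ∧ s ≠ v} : Finset (Fin n)) → i ≠ v → e i = 0) →
      ∀ i, e i ≠ 0 → i ∈ K := by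
    intro u e he i hi
    by_contra hcon
    refine hi (he i (fun h => hcon (Finset.mem_filter.1 h).1) ?_)
    rintro rfl
    exact hcon hv
  have key : ∀ u ∈ A, M.Adj u v → u ≠ v → M.val u v = ‖q u - q v‖ ^ 2 := by
    intro u hu huv huv'
    obtain ⟨e, c, h1, h2, h0, hc⟩ := hdep u hu huv
    have hf0 : ∑ i, (e i - e₀ i) = 0 := by rw [Finset.sum_sub_distrib, h0, h₀0, sub_zero]
    have hfK : ∀ i, e i - e₀ i ≠ 0 → i ∈ K ∧ i ≠ v := by
      intro i hi
      refine ⟨?_, ?_⟩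
      · by_contra hcon
        have a1 : e i = 0 := by_contra fun h => hcon (hsuppK u e h1 i h)
        have a2 : e₀ i = 0 := by_contra fun h => hcon (hsuppK v e₀ h₀1 i h)
        simp [a1, a2] at hi
      · rintro rfl
        simp [h2, h₀2] at hi
    -- The difference of the two dependences vanishes at `v`, so it involves only distances already
    -- realized, and Schoenberg's identity applies to it.
    have hfq : ∑ i, (e i - e₀ i) • q i = 0 := by
      refine sum_smul_eq_zero _ q hf0 ?_
      calc ∑ k, (e k - e₀ k) * ∑ i, (e i - e₀ i) * ‖q k - q i‖ ^ 2
          = ∑ k, (e k - e₀ k) * (c - c₀) := by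
            refine Finset.sum_congr rfl fun k _ => ?_
            by_cases hk : e k - e₀ k = 0
            · simp [hk]
            obtain ⟨hkK, hkv⟩ := hfK k hk
            rw [← hc k (Finset.mem_insert_of_mem hkK), ← h₀c k (Finset.mem_insert_of_mem hkK),
              ← Finset.sum_sub_distrib]
            congr 1
            refine Finset.sum_congr rfl fun i _ => ?_
            by_cases hi : e i - e₀ i = 0
            · rw [← sub_mul, hi, zero_mul, zero_mul]
            obtain ⟨hiK, hiv⟩ := hfK i hi
            rw [← hqd k (hKA hkK) i (hKA hiK) hkv hiv (hK k hkK i hiK), sub_mul]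
        _ = 0 := by rw [← Finset.sum_mul, hf0, zero_mul]
    have hq1 : ∑ i, e i • q i = 0 := by
      simp only [sub_smul, Finset.sum_sub_distrib, hq0, sub_zero] at hfq
      exact hfq
    set N := ∑ i, e i * ‖q i‖ ^ 2 with hN
    have hNq : ∀ x, ∑ i, e i * ‖x - q i‖ ^ 2 = N := fun x => by
      rw [sum_mul_dist_sq e q h0, hq1, inner_zero_right, mul_zero, sub_zero]
    -- All terms but `i = v` agree with the realized distances, so the discrepancy of a whole row is
    -- that of its single entry at `v`.
    have hdiff : ∀ k ∈ A, k ≠ v → (∀ i, e i ≠ 0 → M.Adj k i) →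
        ∑ i, e i * M.val k i - N = M.val k v - ‖q k - q v‖ ^ 2 := by
      intro k hk hkv hki
      rw [← hNq (q k), ← Finset.sum_sub_distrib, Finset.sum_eq_single v]
      · rw [h2]; ring
      · intro i _ hiv
        by_cases hi : e i = 0
        · simp [hi]
        · rw [hqd k hk i (hKA (hsuppK u e h1 i hi)) hkv hiv (hki i hi), sub_self]
      · simp
    -- Every `k` in `K` other than `v` has discrepancy `c - N`. Row `v` has discrepancy `c - N` too,
    -- but it is also the `e`-weighted sum over these `k`, that is `-(c - N)`, since their weights
    -- sum to `-1`.
    have hcN : c = N := by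
      have hg : ∀ k ∈ K, k ≠ v → M.val v k - ‖q v - q k‖ ^ 2 = c - N := by
        intro k hk hkv
        rw [← hc k (Finset.mem_insert_of_mem hk), hdiff k (hKA hk) hkv
          fun i hi => hK k hk i (hsuppK u e h1 i hi), norm_sub_rev, M.val_symm]
      have hv' := hc v (Finset.mem_insert_of_mem hv)
      have : c - N = ∑ i, (e i - if i = v then 1 else 0) * (c - N) := by
        trans ∑ i, (e i * M.val v i - e i * ‖q v - q i‖ ^ 2)
        · rw [Finset.sum_sub_distrib, hv', hNq]
        refine Finset.sum_congr rfl fun i _ => ?_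
        by_cases hiv : i = v
        · subst hiv
          simp [h2, M.val_self]
        · by_cases hi : e i = 0
          · simp [hi, hiv]
          · rw [← mul_sub, hg i (hsuppK u e h1 i hi) hiv]
            simp [hiv]
      rw [← Finset.sum_mul, Finset.sum_sub_distrib, h0] at this
      simp at this
      linarith
    have hu' := hdiff u hu huv' (fun i hi => ?_)
    · rw [hc u (Finset.mem_insert_self _ _), hcN] at hu'
      linarith
    · by_cases hiv : i = v
      · exact hiv ▸ huv
      · by_contra hcon
        exact hi (h1 i (by simp [hcon]) hiv)
  refine ⟨q, fun i hi j hj hij => ?_⟩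
  by_cases hiv : i = v
  · by_cases hjv : j = v
    · rw [hiv, hjv, sub_self, M.val_self]; simp
    · subst hiv
      rw [M.val_symm, norm_sub_rev]
      exact key j hj hij.symm hjv
  · by_cases hjv : j = v
    · subst hjv
      exact key i hi hij hiv
    · exact hqd i hi j hj hiv hjv hij

theorem RealizableOn.mono {d : ℕ} {A B : Finset (Fin n)} (hAB : A ⊆ B)
    (h : M.RealizableOn d B) : M.RealizableOn d A := by
  obtain ⟨p, hp⟩ := h
  exact ⟨p, fun i hi j hj => hp i (hAB hi) j (hAB hj)⟩

/-- Expanding `‖p k - p i‖ ^ 2` writes each column as a combination of `d + 2` vectors: the border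
column, the vector of the `‖p k‖ ^ 2`, and one vector for each of the `d` coordinates. -/
theorem RealizableOn.finrank_le {d : ℕ} {A K : Finset (Fin n)}
    (hA : M.RealizableOn d A) (hKA : K ⊆ A) (hK : ∀ i ∈ K, ∀ j ∈ K, M.Adj i j) :
    Module.finrank ℝ (Submodule.span ℝ (insert (ones K) (M.col K '' K))) ≤ d + 2 := by
  classical
  obtain ⟨p, hp⟩ := hA
  set z : Option (Option (Fin d)) → EuclideanSpace ℝ (Fin (n + 1)) := fun
    | none => ones K
    | some none => WithLp.toLp 2 (Fin.snoc (α := fun _ => ℝ)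
        (fun k => if k ∈ K then ‖p k‖ ^ 2 else 0) 1)
    | some (some j) => WithLp.toLp 2 (Fin.snoc (α := fun _ => ℝ)
        (fun k => if k ∈ K then -2 * p k j else 0) 0) with hz
  have hle : Submodule.span ℝ (insert (ones K) (M.col K '' K)) ≤
      Submodule.span ℝ (Set.range z) := by
    rw [Submodule.span_le]
    rintro _ (rfl | ⟨i, hi, rfl⟩)
    · exact Submodule.subset_span ⟨none, rfl⟩
    · have : M.col K i = ‖p i‖ ^ 2 • z none + z (some none) + ∑ j, p i j • z (some (some j)) := by
        ext k
        simp only [PiLp.add_apply, PiLp.smul_apply, smul_eq_mul, WithLp.ofLp_sum, Finset.sum_apply,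
          WithLp.ofLp_smul, Pi.smul_apply, col, ones, hz]
        refine Fin.lastCases ?_ (fun k => ?_) k
        · simp
        · simp only [Fin.snoc_castSucc]
          by_cases hk : k ∈ K
          · simp only [hk, if_true]
            rw [hp k (hKA hk) i (hKA hi) (hK k hk i hi), norm_sub_sq_real, PiLp.inner_apply,
              Finset.mul_sum, mul_one]
            have : ∑ j, p i j * (-2 * p k j) = - ∑ j, 2 * inner ℝ (p k j) (p i j) := by
              rw [← Finset.sum_neg_distrib]
              refine Finset.sum_congr rfl fun j _ => ?_
              simp only [RCLike.inner_apply, conj_trivial]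
              ring
            rw [this]
            ring
          · simp [hk]
      rw [this]
      have hmem : ∀ o, z o ∈ Submodule.span ℝ (Set.range z) := fun o =>
        Submodule.subset_span (Set.mem_range_self o)
      exact Submodule.add_mem _ (Submodule.add_mem _ (Submodule.smul_mem _ _ (hmem none))
        (hmem (some none)))
        (Submodule.sum_mem _ fun j _ => Submodule.smul_mem _ _ (hmem (some (some j))))
  refine (Submodule.finrank_mono hle).trans ((finrank_range_le_card z).trans ?_)
  simp

/-- The size that the compression guarantees. -/
def Bounded (M : PartialMatrix n) (d m : ℕ) : Prop :=
  ∀ t, 1 ≤ t → M.ExcludesBlock t → m ≤ (d + 1) ^ (20 * t ^ 2)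

theorem bounded_of_coloops {d : ℕ} (hd : 1 ≤ d) {A K : Finset (Fin n)}
    (hsize : ∀ t L, 1 ≤ t → 1 ≤ L → NoBlock M.Adj t → 2 * t * (8 * L) ^ t < A.card → L ≤ K.card)
    (hrank : Module.finrank ℝ (Submodule.span ℝ (insert (ones K) (M.col K '' K))) ≤ d + 2)
    (hcol : ∀ v ∈ K, ∃ u, M.Adj u v ∧ ¬ M.Dep K {s ∈ K | M.Adj u s ∧ s ≠ v} v) :
    M.Bounded d A.card := by
  intro t ht hM
  refine compression_bound hd ht ?_
  by_contra! hcon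
  -- Here `L` is one more than the bound of `NoBlock.card_le_of_coloops`, so too large an `A` would
  -- contain an impossibly large clique.
  have h1 := hsize t _ ht (by omega) hM.noBlock hcon
  have h2 := hM.noBlock.card_le_of_coloops ht (D := d + 2) (by omega) K (M.col K) (ones K) hrank
    (by simpa [Dep] using hcol)
  omega

end PartialMatrix

/-! ### Rank and span membership from Gram–Schmidt residuals. -/

section GramSchmidt

open InnerProductSpace Submodule Module

variable {E : Type*} [NormedAddCommGroup E] [InnerProductSpace ℝ E]

/-- Only field operations occur. If an earlier residual is zero, the quotient by zero is zero, which
is the correct projection, so neither pivoting nor branching is needed. -/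
theorem gramSchmidt_apply {m : ℕ} (f : ℕ → EuclideanSpace ℝ (Fin m)) (i : ℕ) (k : Fin m) :
    gramSchmidt ℝ f i k = f i k - ∑ j ∈ Finset.range i,
      (∑ l, f i l * gramSchmidt ℝ f j l) /
        (∑ l, gramSchmidt ℝ f j l * gramSchmidt ℝ f j l) * gramSchmidt ℝ f j k := by
  rw [gramSchmidt_def]
  simp only [PiLp.sub_apply, WithLp.ofLp_sum, Finset.sum_apply, starProjection_singleton,
    PiLp.smul_apply, smul_eq_mul, Nat.Iio_eq_range]
  congr 1
  refine Finset.sum_congr rfl fun j _ => ?_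
  rw [← real_inner_self_eq_norm_sq, PiLp.inner_apply, PiLp.inner_apply]
  simp only [RCLike.inner_apply, conj_trivial]
  rfl

/-- The residual is orthogonal to the span of the earlier vectors; if `f i` lies in that span, so
does the residual, and it is orthogonal to itself. -/
theorem gramSchmidt_eq_zero_iff (f : ℕ → E) (i : ℕ) :
    gramSchmidt ℝ f i = 0 ↔ f i ∈ span ℝ (f '' Set.Iio i) := by
  have hsum : ∑ j ∈ Finset.Iio i, (ℝ ∙ gramSchmidt ℝ f j).starProjection (f i) ∈
      span ℝ (f '' Set.Iio i) := by
    rw [← span_gramSchmidt_Iio]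
    refine Submodule.sum_mem _ fun j hj => ?_
    have hj' : {gramSchmidt ℝ f j} ⊆ gramSchmidt ℝ f '' Set.Iio i :=
      Set.singleton_subset_iff.2 ⟨j, Finset.mem_Iio.1 hj, rfl⟩
    exact span_mono hj' (starProjection_apply_mem _ _)
  have hdef := gramSchmidt_def' ℝ f i
  constructor
  · intro h
    rw [h, zero_add] at hdef
    rw [hdef]
    exact hsum
  · intro h
    have hmem : gramSchmidt ℝ f i ∈ span ℝ (gramSchmidt ℝ f '' Set.Iio i) := by
      rw [span_gramSchmidt_Iio, gramSchmidt_def]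
      exact sub_mem h hsum
    have horth : gramSchmidt ℝ f i ∈ (span ℝ (gramSchmidt ℝ f '' Set.Iio i))ᗮ := by
      rw [mem_orthogonal]
      intro x hx
      induction hx using span_induction with
      | mem x hx =>
        obtain ⟨j, hj, rfl⟩ := hx
        exact gramSchmidt_orthogonal ℝ f (ne_of_lt hj)
      | zero => simp
      | add x y _ _ hx hy => rw [inner_add_left, hx, hy, add_zero]
      | smul a x _ hx => rw [inner_smul_left, hx, mul_zero]
    exact inner_self_eq_zero.1 (inner_right_of_mem_orthogonal hmem horth)

/-- The nonzero residuals are orthogonal, hence independent, and dropping the zero ones does not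
change the span. -/
theorem card_gramSchmidt_ne_zero (f : ℕ → E) [DecidablePred fun i => gramSchmidt ℝ f i ≠ 0]
    (N : ℕ) :
    ((Finset.range N).filter (fun i => gramSchmidt ℝ f i ≠ 0)).card =
      finrank ℝ (span ℝ (f '' Set.Iio N)) := by
  set J := (Finset.range N).filter (fun i => gramSchmidt ℝ f i ≠ 0) with hJ
  have hli : LinearIndependent ℝ (fun i : J => gramSchmidt ℝ f i) :=
    linearIndependent_of_ne_zero_of_inner_eq_zero (fun i => (Finset.mem_filter.1 i.2).2)
      (fun i j hij => gramSchmidt_orthogonal ℝ f (fun h => hij (Subtype.ext h)))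
  have h1 := finrank_span_eq_card hli
  rw [Fintype.card_coe] at h1
  rw [← h1, ← span_gramSchmidt_Iio ℝ f N]
  suffices h : span ℝ (Set.range fun i : J => gramSchmidt ℝ f i) =
      span ℝ (gramSchmidt ℝ f '' Set.Iio N) by rw [h]
  apply le_antisymm
  · refine span_mono ?_
    rintro _ ⟨⟨i, hi⟩, rfl⟩
    exact ⟨i, Finset.mem_range.1 (Finset.mem_filter.1 hi).1, rfl⟩
  · rw [span_le]
    rintro _ ⟨i, hi, rfl⟩
    by_cases h0 : gramSchmidt ℝ f i = 0
    · rw [h0]; exact zero_mem _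
    · exact subset_span ⟨⟨i, Finset.mem_filter.2 ⟨Finset.mem_range.2 hi, h0⟩⟩, rfl⟩

end GramSchmidt

/-! ### Linear algebra on the real RAM. -/

namespace RealRAM

theorem State.nat_setNat (s : State) (a i j x a' i' j' : ℕ) :
    (s.setNat a i j x).nat a' i' j' = if a' = a ∧ i' = i ∧ j' = j then x else s.nat a' i' j' := rfl

theorem State.real_setNat (s : State) (a i j x : ℕ) : (s.setNat a i j x).real = s.real := rfl

theorem State.nat_setReal (s : State) (a i j : ℕ) (x : ℝ) : (s.setReal a i j x).nat = s.nat := rfl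

theorem State.real_setReal (s : State) (a i j : ℕ) (x : ℝ) (a' i' j' : ℕ) :
    (s.setReal a i j x).real a' i' j' =
      if a' = a ∧ i' = i ∧ j' = j then x else s.real a' i' j' := rfl

namespace Code

theorem run_skip (s : State) : skip.run s = s := rfl

theorem run_setN (a : ℕ) (i j e : NatExpr) (s : State) :
    (setN a i j e).run s = s.setNat a (i.eval s) (j.eval s) (e.eval s) := rfl

theorem run_setR (a : ℕ) (i j : NatExpr) (e : RealExpr) (s : State) :
    (setR a i j e).run s = s.setReal a (i.eval s) (j.eval s) (e.eval s) := rfl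

theorem run_seq (p q : Code) (s : State) : (seq p q).run s = q.run (p.run s) := rfl

open Classical in
theorem run_ite (c : Cond) (p q : Code) (s : State) :
    (ite c p q).run s = if c.Holds s then p.run s else q.run s := rfl

attribute [local simp] run_skip run_setN run_setR run_seq run_ite State.nat_setNat
  State.real_setNat State.nat_setReal State.real_setReal NatExpr.eval RealExpr.eval Cond.Holds

notation:60 p:61 ";;" q:60 => Code.seq p q

/-- Set a scalar variable. -/
abbrev letN (a : ℕ) (e : NatExpr) : Code := setN a (.const 0) (.const 0) e

/-- Set a real scalar variable. -/
abbrev letR (a : ℕ) (e : RealExpr) : Code := setR a (.const 0) (.const 0) e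

/-- The entry of a one-dimensional array. -/
abbrev get (a : ℕ) (i : NatExpr) : NatExpr := .cell a i (.const 0)

/-- The real scalar variable stored in the `a`-th array of real numbers. -/
abbrev rvar (a : ℕ) : RealExpr := .cell a (.const 0) (.const 0)

abbrev rzero : RealExpr := .ofNat (.const 0)

/-! #### Gram–Schmidt orthogonalization

The rows `0, …, n + 1` of the real array `1` are vectors with coordinates `0, …, n`; they are
orthogonalized into array `2`. Variable `24` counts the nonzero results, and variable `23` tells
whether the last one is zero. -/

def copyRow : Code := forN 1 38 (setR 2 (var 36) (var 38) (.cell 1 (var 36) (var 38)))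

theorem run_copyRow (s : State) (i k : ℕ) :
    (copyRow.run s).real 2 i k =
      if i = s.nat 36 0 0 ∧ k < s.nat 0 0 0 + 1 then s.real 1 i k else s.real 2 i k := by
  revert i k
  refine forN_induction (fun K t => ∀ i k, t.real 2 i k =
    if i = s.nat 36 0 0 ∧ k < K then s.real 1 i k else s.real 2 i k) (by simp) ?_
  intro K t hK hctr hN hR ih i k
  simp [hctr, hN 36 (by decide), hR 1 (by decide), ih]
  grind

def dotLoop : Code :=
  letR 3 rzero ;; letR 4 rzero ;;
  forN 1 38 (letR 3 (.add (rvar 3) (.mul (.cell 1 (var 36) (var 38)) (.cell 2 (var 37) (var 38)))) ;;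
    letR 4 (.add (rvar 4) (.mul (.cell 2 (var 37) (var 38)) (.cell 2 (var 37) (var 38)))))

theorem run_dotLoop (s : State) :
    (dotLoop.run s).real 3 0 0 = ∑ k ∈ Finset.range (s.nat 0 0 0 + 1),
      s.real 1 (s.nat 36 0 0) k * s.real 2 (s.nat 37 0 0) k ∧
    (dotLoop.run s).real 4 0 0 = ∑ k ∈ Finset.range (s.nat 0 0 0 + 1),
      s.real 2 (s.nat 37 0 0) k * s.real 2 (s.nat 37 0 0) k := by
  set s₀ := (letR 4 rzero).run ((letR 3 rzero).run s) with hs₀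
  have h := forN_induction (c := 1) (a := 38) (s := s₀)
    (p := (letR 3 (.add (rvar 3) (.mul (.cell 1 (var 36) (var 38)) (.cell 2 (var 37) (var 38)))) ;;
      letR 4 (.add (rvar 4) (.mul (.cell 2 (var 37) (var 38)) (.cell 2 (var 37) (var 38))))))
    (fun K t => t.real 3 0 0 = ∑ k ∈ Finset.range K,
      s.real 1 (s.nat 36 0 0) k * s.real 2 (s.nat 37 0 0) k ∧
      t.real 4 0 0 = ∑ k ∈ Finset.range K,
      s.real 2 (s.nat 37 0 0) k * s.real 2 (s.nat 37 0 0) k)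
    (by simp [hs₀]) (by
      intro K t hK hctr hN hR ih
      simp [hctr, hN 36 (by decide), hN 37 (by decide), hR 1 (by decide), hR 2 (by decide), ih.1,
        ih.2, Finset.sum_range_succ, hs₀])
  exact h

def subRow : Code := forN 1 38 (setR 2 (var 36) (var 38)
  (.sub (.cell 2 (var 36) (var 38)) (.mul (.div (rvar 3) (rvar 4)) (.cell 2 (var 37) (var 38)))))

theorem run_subRow (s : State) (hij : s.nat 37 0 0 ≠ s.nat 36 0 0) (i k : ℕ) :
    (subRow.run s).real 2 i k = if i = s.nat 36 0 0 ∧ k < s.nat 0 0 0 + 1 then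
      s.real 2 i k - s.real 3 0 0 / s.real 4 0 0 * s.real 2 (s.nat 37 0 0) k
      else s.real 2 i k := by
  revert i k
  refine forN_induction (fun K t => ∀ i k, t.real 2 i k = if i = s.nat 36 0 0 ∧ k < K then
      s.real 2 i k - s.real 3 0 0 / s.real 4 0 0 * s.real 2 (s.nat 37 0 0) k
      else s.real 2 i k) (by simp) ?_
  intro K t hK hctr hN hR ih i k
  simp [hctr, hN 36 (by decide), hN 37 (by decide), hR 3 (by decide), hR 4 (by decide), ih, hij]
  grind

/-- Loops have a fixed length, so a guard on the index replaces a shorter range. Coefficients are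
computed from the original row in array `1`, as in `gramSchmidt_apply`. -/
def elimRow : Code :=
  forN 2 37 (ite (.natLE (.add (var 37) (.const 1)) (var 36)) (dotLoop ;; subRow) skip)

theorem run_elimRow (s : State) (q : ℕ → ℕ → ℝ)
    (hq : ∀ j < s.nat 36 0 0, ∀ k < s.nat 0 0 0 + 1, s.real 2 j k = q j k)
    (hi : s.nat 36 0 0 < s.nat 0 0 0 + 2) (i k : ℕ) (hk : k < s.nat 0 0 0 + 1) :
    (elimRow.run s).real 2 i k = if i = s.nat 36 0 0 then s.real 2 i k -
      ∑ j ∈ Finset.range i, (∑ l ∈ Finset.range (s.nat 0 0 0 + 1), s.real 1 i l * q j l) /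
        (∑ l ∈ Finset.range (s.nat 0 0 0 + 1), q j l * q j l) * q j k
      else s.real 2 i k := by
  have h := forN_induction (c := 2) (a := 37) (s := s)
    (p := ite (.natLE (.add (var 37) (.const 1)) (var 36)) (dotLoop ;; subRow) skip)
    (fun J t => ∀ i k, k < s.nat 0 0 0 + 1 →
      t.real 2 i k = if i = s.nat 36 0 0 then s.real 2 i k -
      ∑ j ∈ Finset.range (min J i),
        (∑ l ∈ Finset.range (s.nat 0 0 0 + 1), s.real 1 i l * q j l) /
        (∑ l ∈ Finset.range (s.nat 0 0 0 + 1), q j l * q j l) * q j k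
      else s.real 2 i k) (by simp) (by
      intro J t hJ hctr hN hR ih i k hk
      have e36 : t.nat 36 = s.nat 36 := hN 36 (by decide)
      have e0 : t.nat 0 = s.nat 0 := hN 0 (by decide)
      have e1 : t.real 1 = s.real 1 := hR 1 (by decide)
      by_cases hlt : J < s.nat 36 0 0
      · have hd := run_dotLoop t
        have hrow : ∀ l < s.nat 0 0 0 + 1, t.real 2 J l = q J l := by
          intro l hl
          rw [ih J l hl, if_neg hlt.ne, hq J hlt l hl]
        have d36 : (dotLoop.run t).nat 36 = t.nat 36 := run_nat _ _ (by decide)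
        have d37 : (dotLoop.run t).nat 37 = t.nat 37 := run_nat _ _ (by decide)
        have d0 : (dotLoop.run t).nat 0 = t.nat 0 := run_nat _ _ (by decide)
        have d2 : (dotLoop.run t).real 2 = t.real 2 := run_real _ _ (by decide)
        have hsub := run_subRow (dotLoop.run t) (by rw [d36, d37, hctr, e36]; exact hlt.ne) i k
        rw [d36, d37, d0, d2, hctr, hd.1, hd.2, hctr, e36, e0, e1, ih i k hk] at hsub
        have hs1 : ∑ l ∈ Finset.range (s.nat 0 0 0 + 1), s.real 1 (s.nat 36 0 0) l * t.real 2 J l =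
            ∑ l ∈ Finset.range (s.nat 0 0 0 + 1), s.real 1 (s.nat 36 0 0) l * q J l :=
          Finset.sum_congr rfl fun l hl => by rw [hrow l (Finset.mem_range.1 hl)]
        have hs2 : ∑ l ∈ Finset.range (s.nat 0 0 0 + 1), t.real 2 J l * t.real 2 J l =
            ∑ l ∈ Finset.range (s.nat 0 0 0 + 1), q J l * q J l :=
          Finset.sum_congr rfl fun l hl => by rw [hrow l (Finset.mem_range.1 hl)]
        rw [hs1, hs2, hrow k hk] at hsub
        have hle : J + 1 ≤ s.nat 36 0 0 := hlt
        simp only [run_ite, Cond.Holds, NatExpr.eval, hctr, e36, hle, if_true, run_seq,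
          State.real_setNat, hsub, hk, and_true]
        by_cases hi : i = s.nat 36 0 0
        · simp only [hi, if_true, min_eq_left hle, min_eq_left hlt.le, Finset.sum_range_succ]
          ring
        · simp [hi]
      · have hle : ¬ (J + 1 ≤ s.nat 36 0 0) := hlt
        simp only [run_ite, Cond.Holds, NatExpr.eval, hctr, e36, hle, if_false, run_skip,
          State.real_setNat, ih i k hk]
        by_cases hi : i = s.nat 36 0 0
        · simp only [hi, if_true]
          rw [min_eq_right (by omega), min_eq_right (by omega)]
        · simp [hi])
  have h' := h i k hk
  simp only [elimRow]
  rw [h']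
  by_cases hi' : i = s.nat 36 0 0
  · simp only [hi', if_true]
    rw [min_eq_right (by omega)]
  · simp [hi']

def normLoop : Code :=
  letR 3 rzero ;;
  forN 1 38 (letR 3 (.add (rvar 3) (.mul (.cell 2 (var 36) (var 38)) (.cell 2 (var 36) (var 38)))))

theorem run_normLoop (s : State) :
    (normLoop.run s).real 3 0 0 = ∑ k ∈ Finset.range (s.nat 0 0 0 + 1),
      s.real 2 (s.nat 36 0 0) k * s.real 2 (s.nat 36 0 0) k := by
  set s₀ := (letR 3 rzero).run s with hs₀
  exact forN_induction (c := 1) (a := 38) (s := s₀)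
    (p := letR 3 (.add (rvar 3) (.mul (.cell 2 (var 36) (var 38)) (.cell 2 (var 36) (var 38)))))
    (fun K t => t.real 3 0 0 = ∑ k ∈ Finset.range K,
      s.real 2 (s.nat 36 0 0) k * s.real 2 (s.nat 36 0 0) k)
    (by simp [hs₀]) (by
      intro K t hK hctr hN hR ih
      simp [hctr, hN 36 (by decide), hR 2 (by decide), ih, Finset.sum_range_succ, hs₀])

def orthoStep : Code :=
  copyRow ;; elimRow ;; normLoop ;;
    ite (.realLE (rvar 3) rzero) (letN 23 (.const 1))
      (letN 23 (.const 0) ;; letN 24 (.add (var 24) (.const 1)))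

def ortho : Code := letN 24 (.const 0) ;; forN 2 36 orthoStep

/-- Row `i` of the real array `1` as a vector. -/
noncomputable def rowVec (n : ℕ) (s : State) (i : ℕ) : EuclideanSpace ℝ (Fin (n + 1)) :=
  WithLp.toLp 2 fun k => s.real 1 i k

open Classical InnerProductSpace in
theorem run_orthoStep {n : ℕ} (s : State) (hn : s.nat 0 0 0 = n) (hi : s.nat 36 0 0 < n + 2)
    (hq : ∀ j < s.nat 36 0 0, ∀ k : Fin (n + 1),
      s.real 2 j k = gramSchmidt ℝ (rowVec n s) j k) :
    (∀ j < s.nat 36 0 0 + 1, ∀ k : Fin (n + 1),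
      (orthoStep.run s).real 2 j k = gramSchmidt ℝ (rowVec n s) j k) ∧
    (orthoStep.run s).nat 23 0 0 =
      (if gramSchmidt ℝ (rowVec n s) (s.nat 36 0 0) = 0 then 1 else 0) ∧
    (orthoStep.run s).nat 24 0 0 = s.nat 24 0 0 +
      (if gramSchmidt ℝ (rowVec n s) (s.nat 36 0 0) = 0 then 0 else 1) := by
  set i := s.nat 36 0 0 with hi_def
  set q := gramSchmidt ℝ (rowVec n s) with hq_def
  set qn : ℕ → ℕ → ℝ := fun j l => if h : l < n + 1 then q j ⟨l, h⟩ else 0 with hqn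
  have hqn' : ∀ j (l : Fin (n + 1)), qn j l = q j l := fun j l => by
    simp only [hqn, l.2, dif_pos]
  set s₁ := copyRow.run s with hs₁
  set s₂ := elimRow.run s₁ with hs₂
  set s₃ := normLoop.run s₂ with hs₃
  have a0 : s₁.nat 0 0 0 = n := by rw [hs₁, run_nat _ _ (by decide), hn]
  have a36 : s₁.nat 36 0 0 = i := by rw [hs₁, run_nat _ _ (by decide)]
  have a1 : s₁.real 1 = s.real 1 := run_real _ _ (by decide)
  have hcopy := run_copyRow s
  rw [hn, ← hs₁] at hcopy
  have b0 : s₂.nat 0 0 0 = n := by rw [hs₂, run_nat _ _ (by decide), a0]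
  have b36 : s₂.nat 36 0 0 = i := by rw [hs₂, run_nat _ _ (by decide), a36]
  have helim := run_elimRow s₁ qn (by
    rw [a36, a0]
    intro j hj k hk
    rw [hcopy, if_neg (fun h => hj.ne h.1)]
    exact (hq j hj ⟨k, hk⟩).trans (hqn' j ⟨k, hk⟩).symm) (by rw [a36, a0]; exact hi)
  rw [a0, a36, a1, ← hs₂] at helim
  have hrow : ∀ j < i + 1, ∀ k : Fin (n + 1), s₂.real 2 j k = q j k := by
    intro j hj k
    rw [helim j k k.2]
    by_cases hji : j = i
    · subst hji
      rw [if_pos rfl, hcopy, if_pos ⟨rfl, k.2⟩, hq_def, gramSchmidt_apply]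
      simp only [Finset.sum_range, hqn']
      rfl
    · rw [if_neg hji, hcopy, if_neg (fun h => hji h.1)]
      exact hq j (by omega) k
  have hnorm := run_normLoop s₂
  rw [b0, b36, ← hs₃, Finset.sum_range] at hnorm
  simp only [hrow i (Nat.lt_succ_self i)] at hnorm
  -- The residual is zero exactly when its squared norm is at most zero, so one comparison decides
  -- it.
  have hzero : s₃.real 3 0 0 ≤ 0 ↔ q i = 0 := by
    have : s₃.real 3 0 0 = inner ℝ (q i) (q i) := by
      rw [hnorm, PiLp.inner_apply]
      simp only [RCLike.inner_apply, conj_trivial]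
    rw [this]
    exact real_inner_self_nonpos
  have c24 : s₃.nat 24 0 0 = s.nat 24 0 0 := by
    rw [hs₃, run_nat _ _ (by decide), hs₂, run_nat _ _ (by decide), hs₁, run_nat _ _ (by decide)]
  have c2 : s₃.real 2 = s₂.real 2 := run_real _ _ (by decide)
  have hrun : orthoStep.run s = (ite (.realLE (rvar 3) rzero) (letN 23 (.const 1))
      (letN 23 (.const 0) ;; letN 24 (.add (var 24) (.const 1)))).run s₃ := rfl
  rw [hrun]
  by_cases h0 : q i = 0
  · have := hzero.2 h0
    simp [this, h0, c24, c2]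
    exact fun j hj => hrow j (Nat.lt_succ_of_le hj)
  · have : ¬ s₃.real 3 0 0 ≤ 0 := fun h => h0 (hzero.1 h)
    simp [this, h0, c24, c2]
    exact fun j hj => hrow j (Nat.lt_succ_of_le hj)

open Classical InnerProductSpace in
theorem run_ortho {n : ℕ} (s : State) (hn : s.nat 0 0 0 = n) :
    (ortho.run s).nat 23 0 0 = (if rowVec n s (n + 1) ∈
      Submodule.span ℝ (rowVec n s '' Set.Iio (n + 1)) then 1 else 0) ∧
    (ortho.run s).nat 24 0 0 =
      Module.finrank ℝ (Submodule.span ℝ (rowVec n s '' Set.Iio (n + 2))) := by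
  set q := gramSchmidt ℝ (rowVec n s) with hq
  set s₀ := (letN 24 (.const 0)).run s with hs₀
  have e0 : s₀.nat 0 0 0 = n := by rw [hs₀, run_nat _ _ (by decide), hn]
  have h := forN_induction (c := 2) (a := 36) (s := s₀) (p := orthoStep)
    (fun i t => (∀ j < i, ∀ k : Fin (n + 1), t.real 2 j k = q j k) ∧
      (∀ j, j + 1 = i → t.nat 23 0 0 = if q j = 0 then 1 else 0) ∧
      t.nat 24 0 0 = ((Finset.range i).filter fun j => q j ≠ 0).card) (by simp [hs₀]) (by
      intro i t hi hctr hN hR ⟨ih1, ih2, ih3⟩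
      have hrv : rowVec n t = rowVec n s := by
        have : t.real 1 = s.real 1 := by rw [hR 1 (by decide)]; rfl
        funext j
        simp [rowVec, this]
      have h0 : t.nat 0 0 0 = n := by rw [hN 0 (by decide), e0]
      obtain ⟨h1, h2, h3⟩ := run_orthoStep t h0 (by omega) (by rw [hctr, hrv]; exact ih1)
      rw [hctr, hrv] at h1 h2 h3
      refine ⟨h1, ?_, ?_⟩
      · rintro j hj
        obtain rfl : j = i := by omega
        simpa using h2
      · simp only [State.nat_setNat]
        rw [if_neg (by simp), h3, ih3, Finset.range_add_one, Finset.filter_insert, ← hq]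
        by_cases hqi : q i = 0
        · simp [hqi]
        · simp [hqi])
  rw [e0] at h
  have hrun : ortho.run s = (forN 2 36 orthoStep).run s₀ := rfl
  rw [hrun]
  obtain ⟨-, h2, h3⟩ := h
  refine ⟨?_, ?_⟩
  · rw [h2 (n + 1) rfl]
    simp only [hq, gramSchmidt_eq_zero_iff]
  · rw [h3]
    exact card_gramSchmidt_ne_zero _ _

/-! #### Dependences between columns

Arrays `7` and `8` of natural numbers are the characteristic functions of a set of columns and of
a set of rows of the real array `0`. -/

/-- Multiplying by the masks turns unselected columns into zero vectors, which do not affect spans.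
Index `n` is the border of the Cayley–Menger matrix. -/
def buildRow : Code := forN 1 38 (setR 1 (var 36) (var 38)
  (.mul (.mul (.ofNat (get 7 (var 36))) (.ofNat (get 8 (var 38)))) (.cell 0 (var 38) (var 36))))

theorem run_buildRow (s : State) (i k : ℕ) :
    (buildRow.run s).real 1 i k = if i = s.nat 36 0 0 ∧ k < s.nat 0 0 0 + 1 then
      s.nat 7 i 0 * s.nat 8 k 0 * s.real 0 k i else s.real 1 i k := by
  revert i k
  refine forN_induction (fun K t => ∀ i k, t.real 1 i k =
    if i = s.nat 36 0 0 ∧ k < K then s.nat 7 i 0 * s.nat 8 k 0 * s.real 0 k i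
    else s.real 1 i k) (by simp) ?_
  intro K t hK hctr hN hR ih i k
  simp [hctr, hN 36 (by decide), hN 7 (by decide), hN 8 (by decide), hR 0 (by decide), ih]
  grind

def buildLast : Code := forN 1 38 (setR 1 (.add (var 0) (.const 1)) (var 38)
  (.mul (.ofNat (get 8 (var 38))) (.cell 0 (var 38) (var 34))))

theorem run_buildLast (s : State) (i k : ℕ) :
    (buildLast.run s).real 1 i k = if i = s.nat 0 0 0 + 1 ∧ k < s.nat 0 0 0 + 1 then
      s.nat 8 k 0 * s.real 0 k (s.nat 34 0 0) else s.real 1 i k := by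
  revert i k
  refine forN_induction (fun K t => ∀ i k, t.real 1 i k =
    if i = s.nat 0 0 0 + 1 ∧ k < K then s.nat 8 k 0 * s.real 0 k (s.nat 34 0 0)
    else s.real 1 i k) (by simp) ?_
  intro K t hK hctr hN hR ih i k
  simp [hctr, hN 34 (by decide), hN 0 (by decide), hN 8 (by decide), hR 0 (by decide), ih]
  grind

def depTest : Code := forN 1 36 buildRow ;; buildLast ;; ortho

/-- The state holds the Cayley–Menger matrix of `M` and tells which entries are specified. -/
structure HoldsMatrix (s : State) {n : ℕ} (M : PartialMatrix n) : Prop where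
  size : s.nat 0 0 0 = n
  adj : ∀ i j : Fin n, s.nat 2 i j = if M.Adj i j then 1 else 0
  entry : ∀ i j : Fin n, s.real 0 i j = M.val i j
  row : ∀ i : Fin n, s.real 0 n i = 1
  column : ∀ i : Fin n, s.real 0 i n = 1
  corner : s.real 0 n n = 0

/-- Array `a` of natural numbers is the characteristic function of `A`. -/
def HoldsSet (s : State) (a : ℕ) {n : ℕ} (A : Finset (Fin n)) : Prop :=
  ∀ i : Fin n, s.nat a i 0 = if i ∈ A then 1 else 0

theorem HoldsMatrix.congr {s s' : State} {n : ℕ} {M : PartialMatrix n} (h : HoldsMatrix s M)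
    (h0 : s'.nat 0 = s.nat 0) (h2 : s'.nat 2 = s.nat 2) (hr : s'.real 0 = s.real 0) :
    HoldsMatrix s' M where
  size := by rw [h0, h.size]
  adj := by rw [h2]; exact h.adj
  entry := by rw [hr]; exact h.entry
  row := by rw [hr]; exact h.row
  column := by rw [hr]; exact h.column
  corner := by rw [hr]; exact h.corner

theorem HoldsSet.congr {s s' : State} {a n : ℕ} {A : Finset (Fin n)} (h : HoldsSet s a A)
    (ha : s'.nat a = s.nat a) : HoldsSet s' a A := by
  intro i
  rw [ha, h i]

-- Rows below `n` hold the columns in `S`, row `n` the border and row `n + 1` column `v`. One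
-- orthogonalization thus answers both questions: the last residual decides the dependence, and the
-- number of nonzero residuals is the rank.
open Classical in
theorem run_depTest {n : ℕ} {M : PartialMatrix n} {s : State} {S C : Finset (Fin n)} {v : Fin n}
    (hM : HoldsMatrix s M) (hS : HoldsSet s 7 S) (hSn : s.nat 7 n 0 = 1) (hC : HoldsSet s 8 C)
    (hCn : s.nat 8 n 0 = 1) (hv : s.nat 34 0 0 = v) :
    (depTest.run s).nat 23 0 0 = (if M.Dep C S v then 1 else 0) ∧
    (depTest.run s).nat 24 0 0 = Module.finrank ℝ (Submodule.span ℝ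
      (insert (PartialMatrix.ones C) (M.col C '' (insert v S : Finset (Fin n))))) := by
  have hn := hM.size
  set s₁ := (forN 1 36 buildRow).run s with hs₁
  set s₂ := buildLast.run s₁ with hs₂
  have h1 : ∀ i < n + 1, ∀ k < n + 1, s₁.real 1 i k = s.nat 7 i 0 * s.nat 8 k 0 * s.real 0 k i := by
    have := forN_induction (c := 1) (a := 36) (s := s) (p := buildRow)
      (fun I t => ∀ i < I, ∀ k < n + 1,
        t.real 1 i k = s.nat 7 i 0 * s.nat 8 k 0 * s.real 0 k i) (by simp) (by
        intro I t hI hctr hN hR ih i hi k hk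
        have e0 : t.nat 0 0 0 = n := by rw [hN 0 (by decide), hn]
        simp only [State.real_setNat]
        rw [run_buildRow, hctr, e0, hN 7 (by decide), hN 8 (by decide), hR 0 (by decide)]
        by_cases hiI : i = I
        · rw [if_pos ⟨hiI, hk⟩]
        · rw [if_neg (fun h => hiI h.1), ih i (by omega) k hk])
    rw [hn] at this
    exact this
  have f0 : s₁.nat 0 = s.nat 0 := run_nat _ _ (by decide)
  have f8 : s₁.nat 8 = s.nat 8 := run_nat _ _ (by decide)
  have f34 : s₁.nat 34 = s.nat 34 := run_nat _ _ (by decide)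
  have g0 : s₁.real 0 = s.real 0 := run_real _ _ (by decide)
  have h2 := run_buildLast s₁
  rw [f0, f8, f34, g0, hn, ← hs₂, hv] at h2
  have hf2 : s₂.nat 0 0 0 = n := by rw [hs₂, run_nat _ _ (by decide), f0, hn]
  have hlast : rowVec n s₂ (n + 1) = M.col C v := by
    ext k
    simp only [rowVec, PartialMatrix.col]
    rw [h2, if_pos ⟨rfl, k.2⟩]
    refine Fin.lastCases ?_ (fun k => ?_) k
    · simp [hCn, hM.row]
    · simp [hC k, hM.entry]
  have hrow : ∀ i : Fin n, rowVec n s₂ i = if i ∈ S then M.col C i else 0 := by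
    intro i
    ext k
    have : rowVec n s₂ i k = s.nat 7 i 0 * s.nat 8 k 0 * s.real 0 k i := by
      simp only [rowVec]
      rw [h2, if_neg (fun h => by have := i.2; omega), h1 i (by have := i.2; omega) k k.2]
    rw [this, hS i]
    by_cases hi : i ∈ S
    · simp only [hi, if_true, PartialMatrix.col]
      refine Fin.lastCases ?_ (fun k => ?_) k
      · simp [hCn, hM.row]
      · simp [hC k, hM.entry]
    · simp [hi]
  have hones : rowVec n s₂ n = PartialMatrix.ones C := by
    ext k
    have : rowVec n s₂ n k = s.nat 7 n 0 * s.nat 8 k 0 * s.real 0 k n := by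
      simp only [rowVec]
      rw [h2, if_neg (fun h => by omega), h1 n (by omega) k k.2]
    rw [this, hSn]
    simp only [PartialMatrix.ones]
    refine Fin.lastCases ?_ (fun k => ?_) k
    · simp [hM.corner]
    · simp [hC k, hM.column]
  have hspan : Submodule.span ℝ (rowVec n s₂ '' Set.Iio (n + 1)) =
      Submodule.span ℝ (insert (PartialMatrix.ones C) (M.col C '' S)) := by
    apply le_antisymm <;> rw [Submodule.span_le]
    · rintro _ ⟨i, hi, rfl⟩
      rcases Nat.lt_succ_iff_lt_or_eq.1 hi with hi | rfl
      · have := hrow ⟨i, hi⟩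
        simp only at this
        rw [this]
        split_ifs with h
        · exact Submodule.subset_span (Set.mem_insert_of_mem _ ⟨_, h, rfl⟩)
        · exact zero_mem _
      · rw [hones]
        exact Submodule.subset_span (Set.mem_insert _ _)
    · rintro _ (rfl | ⟨i, hi, rfl⟩)
      · exact Submodule.subset_span ⟨n, by simp, hones⟩
      · refine Submodule.subset_span ⟨i, ?_, ?_⟩
        · simp only [Set.mem_Iio]; have := i.2; omega
        · rw [hrow, if_pos (Finset.mem_coe.1 hi)]
  have hrun : depTest.run s = ortho.run s₂ := rfl
  obtain ⟨o1, o2⟩ := run_ortho s₂ hf2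
  rw [hrun, o1, o2, hlast, hspan]
  refine ⟨rfl, ?_⟩
  have : Set.Iio (n + 2) = insert (n + 1) (Set.Iio (n + 1)) := by
    ext i; simp only [Set.mem_Iio, Set.mem_insert_iff]; omega
  rw [this, Set.image_insert_eq, hlast, Submodule.span_insert, hspan, Finset.coe_insert,
    Set.image_insert_eq, Set.insert_comm, ← Submodule.span_insert]

end Code

end RealRAM

theorem card_filter_lt_succ {n k : ℕ} (hk : k < n) (P : Fin n → Prop) [DecidablePred P] :
    (Finset.univ.filter fun y : Fin n => P y ∧ (y : ℕ) < k + 1).card =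
      (Finset.univ.filter fun y : Fin n => P y ∧ (y : ℕ) < k).card +
        if P ⟨k, hk⟩ then 1 else 0 := by
  by_cases h : P ⟨k, hk⟩
  · have : (Finset.univ.filter fun y : Fin n => P y ∧ (y : ℕ) < k + 1) =
        insert ⟨k, hk⟩ (Finset.univ.filter fun y : Fin n => P y ∧ (y : ℕ) < k) := by
      ext y
      simp only [Finset.mem_filter, Finset.mem_univ, true_and, Finset.mem_insert, Fin.ext_iff]
      constructor
      · rintro ⟨h1, h2⟩
        by_cases hy : (y : ℕ) = k
        · exact .inl hy
        · exact .inr ⟨h1, by omega⟩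
      · rintro (h1 | ⟨h1, h2⟩)
        · obtain rfl : y = ⟨k, hk⟩ := Fin.ext h1
          exact ⟨h, by simp⟩
        · exact ⟨h1, by omega⟩
    rw [this, Finset.card_insert_of_notMem (by simp), if_pos h]
  · rw [if_neg h, add_zero]
    congr 1
    ext y
    simp only [Finset.mem_filter, Finset.mem_univ, true_and]
    refine and_congr_right fun hy => ?_
    have : (y : ℕ) ≠ k := by
      rintro h1
      obtain rfl : y = ⟨k, hk⟩ := Fin.ext h1
      exact h hy
    omega

open Finset in
/-- One step of the greedy construction of a clique. -/
theorem NoBlock.greedy_step {V : Type*} [DecidableEq V] {adj : V → V → Prop} [DecidableRel adj]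
    (hrefl : ∀ x, adj x x) {t L m i : ℕ} (h : NoBlock adj t) (ht : 1 ≤ t) (hL : 1 ≤ L)
    (hm : 2 * t * (8 * L) ^ t < m) {X : Finset V} (hXm : #X ≤ m) (hi : i < L)
    (hX : m * (2 * L - i) ≤ 2 * L * #X) {b : V} (hb : b ∈ X)
    (hmax : ∀ x ∈ X, #{y ∈ X | adj x y} ≤ #{y ∈ X | adj b y}) :
    m * (2 * L - (i + 1)) ≤ 2 * L * #{y ∈ X | adj b y ∧ y ≠ b} := by
  have h8 : 8 * L ≤ (8 * L) ^ t := Nat.le_self_pow (by omega) _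
  have h16 : 16 * L ≤ m := by nlinarith
  -- The invariant reads `#X ≥ m * (1 - i / (2 * L))`; for `i < L` at least half of `m` is left.
  have hXbig : t * (8 * L) ^ t < #X := by
    have h1 : m * L ≤ m * (2 * L - i) := Nat.mul_le_mul_left _ (by omega)
    have h2 : L * m ≤ L * (2 * #X) := by nlinarith
    have h3 := Nat.le_of_mul_le_mul_left h2 hL
    nlinarith
  obtain ⟨b₀, hb₀, hfew⟩ := h.exists_few_nonadj ht X L hL hXbig
  have h1 := hmax b₀ hb₀
  have h2 : #{y ∈ X | adj b₀ y} + #{y ∈ X | ¬ adj b₀ y} = #X :=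
    card_filter_add_card_filter_not _
  have h3 : #{y ∈ X | adj b y ∧ y ≠ b} + 1 = #{y ∈ X | adj b y} := by
    have : {y ∈ X | adj b y ∧ y ≠ b} = {y ∈ X | adj b y}.erase b := by
      ext y; simp only [mem_filter, mem_erase]; tauto
    rw [this, card_erase_add_one (mem_filter.2 ⟨hb, hrefl b⟩)]
  set x := #X
  set g := #{y ∈ X | adj b y ∧ y ≠ b}
  set g₀ := #{y ∈ X | ¬ adj b₀ y}
  -- Passing to the other neighbours of `b` loses at most `#X / (4 * L) + 1` vertices, and this is
  -- at most `m / (2 * L)` because `16 * L ≤ m`.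
  have h4 : x ≤ g + 1 + g₀ := by omega
  have h5 : 4 * L * x ≤ 4 * L * g + 4 * L + 4 * L * g₀ := by nlinarith
  have h6 : m * (2 * L - i) = m * (2 * L - (i + 1)) + m := by
    rw [← Nat.mul_succ]; congr 1; omega
  nlinarith

/-! ### Greedy construction of a clique. -/

namespace RealRAM

namespace Code

attribute [local simp] run_skip run_setN run_setR run_seq run_ite State.nat_setNat
  State.real_setNat State.nat_setReal State.real_setReal NatExpr.eval RealExpr.eval Cond.Holds

/-! #### A greedy clique

Array `4` is the characteristic function of the set of vertices that are still there. The clique is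
built in array `6`, its common neighbours are in array `5`, and the next vertex of the clique, in
variable `16`, is one with the most neighbours among those, in variable `17`. -/

def countNbrs : Code :=
  letN 18 (.const 0) ;;
  forN 0 33 (ite (.conj (.natLE (.const 1) (get 5 (var 33)))
    (.natLE (.const 1) (.cell 2 (var 32) (var 33)))) (letN 18 (.add (var 18) (.const 1))) skip)

theorem run_countNbrs {n : ℕ} {M : PartialMatrix n} {s : State} {X : Finset (Fin n)} {x : Fin n}
    (hM : HoldsMatrix s M) (hX : HoldsSet s 5 X) (hx : s.nat 32 0 0 = x) :
    (countNbrs.run s).nat 18 0 0 = (X.filter fun y => M.Adj x y).card := by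
  set s₀ := (letN 18 (.const 0)).run s with hs₀
  have h := forN_induction (c := 0) (a := 33) (s := s₀)
    (p := ite (.conj (.natLE (.const 1) (get 5 (var 33)))
      (.natLE (.const 1) (.cell 2 (var 32) (var 33)))) (letN 18 (.add (var 18) (.const 1))) skip)
    (fun k t => t.nat 18 0 0 =
      (Finset.univ.filter fun y : Fin n => (y ∈ X ∧ M.Adj x y) ∧ (y : ℕ) < k).card)
    (by simp [hs₀]) (by
      intro k t hk hctr hN hR ih
      have e5 : t.nat 5 = s.nat 5 := (hN 5 (by decide)).trans (run_nat _ _ (by decide))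
      have e2 : t.nat 2 = s.nat 2 := (hN 2 (by decide)).trans (run_nat _ _ (by decide))
      have e32 : t.nat 32 = s.nat 32 := (hN 32 (by decide)).trans (run_nat _ _ (by decide))
      have hk' : k < n := by
        have := hM.size
        simpa [hs₀, this] using hk
      have h5 := hX ⟨k, hk'⟩
      have h2 := hM.adj x ⟨k, hk'⟩
      simp only at h5 h2
      rw [card_filter_lt_succ hk', ← ih]
      by_cases h1 : (⟨k, hk'⟩ : Fin n) ∈ X <;> by_cases h3 : M.Adj x ⟨k, hk'⟩ <;>
        simp [hctr, e5, e2, e32, hx, h5, h2, h1, h3])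
  have hn : s₀.nat 0 0 0 + 0 = n := by simp [hs₀, hM.size]
  rw [hn] at h
  refine Eq.trans h ?_
  congr 1
  ext y
  simp

def pickBest : Code :=
  letN 17 (.const 0) ;;
  forN 0 32 (ite (.natLE (.const 1) (get 5 (var 32))) (countNbrs ;;
    ite (.natLE (.add (var 17) (.const 1)) (var 18)) (letN 16 (var 32) ;; letN 17 (var 18)) skip)
    skip)

/-- Each candidate is its own neighbour, so a best count of zero means exactly that no candidate is
left. -/
theorem run_pickBest {n : ℕ} {M : PartialMatrix n} {s : State} {X : Finset (Fin n)}
    (hM : HoldsMatrix s M) (hX : HoldsSet s 5 X) :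
    ((pickBest.run s).nat 17 0 0 = 0 ∧ X = ∅) ∨
    (1 ≤ (pickBest.run s).nat 17 0 0 ∧ ∃ b ∈ X, (pickBest.run s).nat 16 0 0 = b ∧
      ∀ x ∈ X, (X.filter fun y => M.Adj x y).card ≤ (X.filter fun y => M.Adj b y).card) := by
  set s₀ := (letN 17 (.const 0)).run s with hs₀
  have h := forN_induction (c := 0) (a := 32) (s := s₀)
    (p := ite (.natLE (.const 1) (get 5 (var 32))) (countNbrs ;;
      ite (.natLE (.add (var 17) (.const 1)) (var 18)) (letN 16 (var 32) ;; letN 17 (var 18)) skip)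
      skip)
    (fun k t => (∀ x ∈ X, (x : ℕ) < k → (X.filter fun y => M.Adj x y).card ≤ t.nat 17 0 0) ∧
      (t.nat 17 0 0 = 0 ∨ ∃ b ∈ X, t.nat 16 0 0 = b ∧
        (X.filter fun y => M.Adj b y).card = t.nat 17 0 0))
    (by simp [hs₀]) (by
      intro k t hk hctr hN hR ⟨ih1, ih2⟩
      have e5 : t.nat 5 = s.nat 5 := (hN 5 (by decide)).trans (run_nat _ _ (by decide))
      have e2 : t.nat 2 = s.nat 2 := (hN 2 (by decide)).trans (run_nat _ _ (by decide))
      have e0 : t.nat 0 = s.nat 0 := (hN 0 (by decide)).trans (run_nat _ _ (by decide))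
      have er : t.real 0 = s.real 0 := (hR 0 (by decide)).trans (run_real _ _ (by decide))
      have hk' : k < n := by
        have := hM.size
        simpa [hs₀, this] using hk
      have h5 := hX ⟨k, hk'⟩
      simp only at h5
      by_cases h1 : (⟨k, hk'⟩ : Fin n) ∈ X
      · have hc := run_countNbrs (x := ⟨k, hk'⟩) (hM.congr e0 e2 er) (hX.congr e5) hctr
        have c17 : (countNbrs.run t).nat 17 = t.nat 17 := run_nat _ _ (by decide)
        have c16 : (countNbrs.run t).nat 16 = t.nat 16 := run_nat _ _ (by decide)
        have c32 : (countNbrs.run t).nat 32 = t.nat 32 := run_nat _ _ (by decide)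
        by_cases hlt : t.nat 17 0 0 + 1 ≤ (X.filter fun y => M.Adj ⟨k, hk'⟩ y).card
        · simp only [run_ite, Cond.Holds, NatExpr.eval, hctr, e5, h5, h1, if_true, le_refl, run_seq,
            hc, c17, hlt]
          simp only [run_setN, State.nat_setNat, NatExpr.eval, c32, hctr, hc]
          simp only [Nat.reduceEqDiff, false_and, if_false, and_self, if_true]
          refine ⟨fun x hx hxk => ?_, .inr ⟨⟨k, hk'⟩, h1, by simp⟩⟩
          by_cases hxk' : (x : ℕ) = k
          · obtain rfl : x = ⟨k, hk'⟩ := Fin.ext hxk'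
            simp
          · have := ih1 x hx (by omega)
            simp
            omega
        · simp only [run_ite, Cond.Holds, NatExpr.eval, hctr, e5, h5, h1, if_true, le_refl, run_seq,
            hc, c17, hlt, if_false, run_skip, State.nat_setNat]
          simp only [Nat.reduceEqDiff, false_and, if_false, c16]
          refine ⟨fun x hx hxk => ?_, ih2⟩
          by_cases hxk' : (x : ℕ) = k
          · obtain rfl : x = ⟨k, hk'⟩ := Fin.ext hxk'
            omega
          · exact ih1 x hx (by omega)
      · simp only [run_ite, Cond.Holds, NatExpr.eval, hctr, e5, h5, h1, if_false, run_skip,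
          State.nat_setNat]
        simp only [Nat.reduceEqDiff, false_and, if_false, Nat.reduceLeDiff]
        refine ⟨fun x hx hxk => ?_, ih2⟩
        refine ih1 x hx ?_
        by_contra hcon
        obtain rfl : x = ⟨k, hk'⟩ := Fin.ext (by simp only; omega)
        exact h1 hx)
  have hn : s₀.nat 0 0 0 + 0 = n := by simp [hs₀, hM.size]
  rw [hn] at h
  obtain ⟨h1, h2⟩ := h
  have hrun : pickBest.run s = (forN 0 32 (ite (.natLE (.const 1) (get 5 (var 32))) (countNbrs ;;
      ite (.natLE (.add (var 17) (.const 1)) (var 18)) (letN 16 (var 32) ;; letN 17 (var 18)) skip)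
      skip)).run s₀ := rfl
  rw [← hrun] at h1 h2
  rcases Nat.eq_zero_or_pos ((pickBest.run s).nat 17 0 0) with h0 | hpos
  · refine .inl ⟨h0, Finset.eq_empty_of_forall_notMem fun x hx => ?_⟩
    have h3 := h1 x hx x.2
    rw [h0, Nat.le_zero, Finset.card_eq_zero] at h3
    have : x ∈ X.filter fun y => M.Adj x y := Finset.mem_filter.2 ⟨hx, M.adj_self x⟩
    rw [h3] at this
    simp at this
  · rcases h2 with h2 | ⟨b, hb, hb1, hb2⟩
    · omega
    · exact .inr ⟨hpos, b, hb, hb1, fun x hx => by rw [hb2]; exact h1 x hx x.2⟩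

def dropNonNbrs : Code :=
  forN 0 33 (ite (.natLE (.const 1) (.cell 2 (var 16) (var 33))) skip
    (setN 5 (var 33) (.const 0) (.const 0)))

theorem run_dropNonNbrs {n : ℕ} {M : PartialMatrix n} {s : State} {X : Finset (Fin n)} {b : Fin n}
    (hM : HoldsMatrix s M) (hX : HoldsSet s 5 X) (hb : s.nat 16 0 0 = b) :
    HoldsSet (dropNonNbrs.run s) 5 (X.filter fun y => M.Adj b y) := by
  have h := forN_induction (c := 0) (a := 33) (s := s)
    (p := ite (.natLE (.const 1) (.cell 2 (var 16) (var 33))) skip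
      (setN 5 (var 33) (.const 0) (.const 0)))
    (fun k t => ∀ y : Fin n, t.nat 5 y 0 = if y ∈ X ∧ ((y : ℕ) < k → M.Adj b y) then 1 else 0)
    (fun y => by simpa using hX y) (by
      intro k t hk hctr hN hR ih y
      have e2 : t.nat 2 = s.nat 2 := hN 2 (by decide)
      have e16 : t.nat 16 = s.nat 16 := hN 16 (by decide)
      have hk' : k < n := by
        have := hM.size
        simpa [this] using hk
      have h2 := hM.adj b ⟨k, hk'⟩
      simp only at h2
      by_cases hyk : (y : ℕ) = k
      · obtain rfl : y = ⟨k, hk'⟩ := Fin.ext hyk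
        have ihk := ih ⟨k, hk'⟩
        simp only [lt_irrefl, false_imp_iff, and_true] at ihk
        by_cases h3 : M.Adj b ⟨k, hk'⟩ <;> simp [hctr, e2, e16, hb, h2, h3, ihk]
      · have : (y : ℕ) < k + 1 ↔ (y : ℕ) < k := by omega
        by_cases h3 : M.Adj b ⟨k, hk'⟩ <;>
          simp [hctr, e2, e16, hb, h2, h3, ih, hyk, this, -Order.lt_add_one_iff])
  have hn : s.nat 0 0 0 + 0 = n := by simp [hM.size]
  rw [hn] at h
  intro y
  refine (h y).trans ?_
  simp

/-- Dropping the non-neighbours keeps the chosen vertex itself, which is why it is removed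
separately. -/
def addBest : Code :=
  ite (.natLE (.const 1) (var 17)) (setN 6 (var 16) (.const 0) (.const 1) ;; dropNonNbrs ;;
    setN 5 (var 16) (.const 0) (.const 0)) skip

theorem run_addBest {n : ℕ} {M : PartialMatrix n} {s : State} {X K : Finset (Fin n)} {b : Fin n}
    (hM : HoldsMatrix s M) (hX : HoldsSet s 5 X) (hK : HoldsSet s 6 K) (h1 : 1 ≤ s.nat 17 0 0)
    (hb : s.nat 16 0 0 = b) :
    HoldsSet (addBest.run s) 5 (X.filter fun y => M.Adj b y ∧ y ≠ b) ∧
    HoldsSet (addBest.run s) 6 (insert b K) := by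
  set s₁ := (setN 6 (var 16) (.const 0) (.const 1)).run s with hs₁
  have hd := run_dropNonNbrs (s := s₁) (b := b)
    (hM.congr (run_nat _ _ (by decide)) (run_nat _ _ (by decide)) rfl)
    (hX.congr (run_nat _ _ (by decide))) (by rw [hs₁, run_nat _ _ (by decide), hb])
  have d16 : (dropNonNbrs.run s₁).nat 16 0 0 = b := by
    rw [run_nat _ _ (by decide), hs₁, run_nat _ _ (by decide), hb]
  have d6 : ∀ y, (dropNonNbrs.run s₁).nat 6 y 0 = if y = b then 1 else s.nat 6 y 0 := by
    intro y
    rw [run_nat _ _ (by decide)]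
    simp [hs₁, hb]
  have hrun : addBest.run s =
      (setN 5 (var 16) (.const 0) (.const 0)).run (dropNonNbrs.run s₁) := by
    simp only [addBest, run_ite, Cond.Holds, NatExpr.eval, h1, if_true]
    rfl
  rw [hrun]
  constructor
  · intro y
    have := hd y
    by_cases hyb : y = b
    · simp [d16, hyb]
    · have hyb' : (y : ℕ) ≠ b := fun h => hyb (Fin.ext h)
      simp [d16, hyb, hyb', this]
  · intro y
    have := hK y
    by_cases hyb : y = b
    · simp [d6, hyb]
    · have hyb' : (y : ℕ) ≠ b := fun h => hyb (Fin.ext h)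
      simp [d6, hyb, hyb', this]

def initClique : Code :=
  forN 0 33 (setN 5 (var 33) (.const 0) (get 4 (var 33)) ;;
    setN 6 (var 33) (.const 0) (.const 0))

theorem run_initClique {n : ℕ} {s : State} {A : Finset (Fin n)} (hn : s.nat 0 0 0 = n)
    (hA : HoldsSet s 4 A) :
    HoldsSet (initClique.run s) 5 A ∧ HoldsSet (initClique.run s) 6 (∅ : Finset (Fin n)) := by
  have h := forN_induction (c := 0) (a := 33) (s := s)
    (p := setN 5 (var 33) (.const 0) (get 4 (var 33)) ;;
      setN 6 (var 33) (.const 0) (.const 0))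
    (fun k t => ∀ y : Fin n, (y : ℕ) < k →
      t.nat 5 y 0 = (if y ∈ A then 1 else 0) ∧ t.nat 6 y 0 = 0)
    (by simp) (by
      intro k t hk hctr hN hR ih y hy
      have e4 : t.nat 4 = s.nat 4 := hN 4 (by decide)
      by_cases hyk : (y : ℕ) = k
      · have := hA y
        rw [hyk] at this
        simp [hctr, e4, hyk, this]
      · have := ih y (by omega)
        simp [hctr, hyk, this.1, this.2])
  rw [hn] at h
  exact ⟨fun y => (h y y.2).1, fun y => (h y y.2).2.trans (by simp)⟩

def clique : Code := initClique ;; forN 0 31 (pickBest ;; addBest)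

/-- `K` is a clique in `A`, and a large one if there is no block. -/
structure IsGoodClique {n : ℕ} (M : PartialMatrix n) (A K : Finset (Fin n)) : Prop where
  subset : K ⊆ A
  adj : ∀ i ∈ K, ∀ j ∈ K, M.Adj i j
  size : ∀ t L, 1 ≤ t → 1 ≤ L → NoBlock M.Adj t → 2 * t * (8 * L) ^ t < A.card → L ≤ K.card

/-- The program knows neither `t` nor `L`; the loop invariant holds for all of them at once. -/
theorem run_clique {n : ℕ} {M : PartialMatrix n} {s : State} {A : Finset (Fin n)}
    (hM : HoldsMatrix s M) (hA : HoldsSet s 4 A) :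
    ∃ K, HoldsSet (clique.run s) 6 K ∧ IsGoodClique M A K := by
  set s₀ := initClique.run s with hs₀
  obtain ⟨i5, i6⟩ := run_initClique hM.size hA
  have hM₀ : HoldsMatrix s₀ M :=
    hM.congr (run_nat _ _ (by decide)) (run_nat _ _ (by decide)) (run_real _ _ (by decide))
  have h := forN_induction (c := 0) (a := 31) (s := s₀) (p := pickBest ;; addBest)
    (fun k t => ∃ X K : Finset (Fin n), HoldsSet t 5 X ∧ HoldsSet t 6 K ∧ X ⊆ A ∧ K ⊆ A ∧
      (∀ i ∈ K, ∀ j ∈ K, M.Adj i j) ∧ (∀ i ∈ K, ∀ j ∈ X, M.Adj i j) ∧ Disjoint X K ∧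
      ∀ t L, 1 ≤ t → 1 ≤ L → NoBlock M.Adj t → 2 * t * (8 * L) ^ t < A.card →
        min k L ≤ K.card ∧ (k ≤ L → A.card * (2 * L - k) ≤ 2 * L * X.card))
    ⟨A, ∅, i5.congr rfl, i6.congr rfl, by simp, by simp, by simp, by simp, by simp,
      fun t L _ _ _ _ => ⟨by simp, fun _ => by simp; nlinarith⟩⟩ (by
      rintro k t hk hctr hN hR ⟨X, K, hX, hK, hXA, hKA, hKK, hKX, hdis, hsize⟩
      have hMt : HoldsMatrix t M :=
        hM₀.congr (hN 0 (by decide)) (hN 2 (by decide)) (hR 0 (by decide))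
      have hMp : HoldsMatrix (pickBest.run t) M :=
        hMt.congr (run_nat _ _ (by decide)) (run_nat _ _ (by decide)) (run_real _ _ (by decide))
      have hXp : HoldsSet (pickBest.run t) 5 X := hX.congr (run_nat _ _ (by decide))
      have hKp : HoldsSet (pickBest.run t) 6 K := hK.congr (run_nat _ _ (by decide))
      rcases run_pickBest hMt hX with ⟨h17, rfl⟩ | ⟨h17, b, hbX, hb, hmax⟩
      · have hrun : (pickBest ;; addBest).run t = pickBest.run t := by
          simp [addBest, h17]
        rw [hrun]
        refine ⟨∅, K, hXp, hKp, hXA, hKA, hKK, hKX, hdis, fun t L ht hL hnb hbig => ?_⟩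
        obtain ⟨z1, z2⟩ := hsize t L ht hL hnb hbig
        -- Running out of candidates before `L` steps would contradict the invariant, which gives
        -- `A.card * (2 * L - k) ≤ 0`.
        by_cases hkL : k < L
        · have := z2 hkL.le
          simp only [Finset.card_empty, mul_zero, Nat.le_zero, mul_eq_zero] at this
          omega
        · exact ⟨by omega, fun h => by omega⟩
      · obtain ⟨h5, h6⟩ := run_addBest hMp hXp hKp h17 hb
        have hbK : b ∉ K := Finset.disjoint_left.1 hdis hbX
        refine ⟨_, _, h5, h6, (Finset.filter_subset _ _).trans hXA, ?_, ?_, ?_, ?_, ?_⟩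
        · exact Finset.insert_subset (hXA hbX) hKA
        · intro i hi j hj
          rw [Finset.mem_insert] at hi hj
          rcases hi with rfl | hi
          · rcases hj with rfl | hj
            · exact M.adj_self _
            · exact (hKX j hj i hbX).symm
          · rcases hj with rfl | hj
            · exact hKX i hi j hbX
            · exact hKK i hi j hj
        · intro i hi j hj
          obtain ⟨hjX, hbj, -⟩ := Finset.mem_filter.1 hj
          rcases Finset.mem_insert.1 hi with rfl | hi
          · exact hbj
          · exact hKX i hi j hjX
        · rw [Finset.disjoint_left]
          intro j hj hjK
          obtain ⟨hjX, -, hjb⟩ := Finset.mem_filter.1 hj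
          rcases Finset.mem_insert.1 hjK with rfl | hjK
          · exact hjb rfl
          · exact Finset.disjoint_left.1 hdis hjX hjK
        · intro t L ht hL hnb hbig
          obtain ⟨z1, z2⟩ := hsize t L ht hL hnb hbig
          rw [Finset.card_insert_of_notMem hbK]
          refine ⟨by omega, fun hkL => ?_⟩
          exact hnb.greedy_step M.adj_self ht hL hbig (Finset.card_le_card hXA) (by omega)
            (z2 (by omega)) hbX hmax)
  have hn : s₀.nat 0 0 0 + 0 = n := by rw [hM₀.size, add_zero]
  rw [hn] at h
  obtain ⟨X, K, -, hK, -, hKA, hKK, -, -, hsize⟩ := h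
  refine ⟨K, hK, hKA, hKK, fun t L ht hL hnb hbig => ?_⟩
  have h1 := (hsize t L ht hL hnb hbig).1
  have h2 : A.card ≤ n := by simpa using Finset.card_le_univ A
  have h8 : 8 * L ≤ (8 * L) ^ t := Nat.le_self_pow (by omega) _
  -- Since `L` is below `A.card`, the `n` iterations suffice to reach size `L`.
  have h3 : L ≤ n := by nlinarith
  rwa [min_eq_right h3] at h1

end Code

end RealRAM

/-! ### Redundant points and obstructions to realizability. -/

namespace PartialMatrix

variable {n : ℕ} {M : PartialMatrix n}

/-- The neighbours of `u` in `K` other than `v`. -/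
def nbrs (M : PartialMatrix n) (K : Finset (Fin n)) (u v : Fin n) : Finset (Fin n) :=
  {s ∈ K | M.Adj u s ∧ s ≠ v}

/-- The point `v` of the clique `K` is redundant in `A`. -/
def Redundant (M : PartialMatrix n) (A K : Finset (Fin n)) (v : Fin n) : Prop :=
  ∀ u ∈ A, M.Adj u v → M.Dep (insert u K) (M.nbrs K u v) v

/-- Necessary conditions for a realization. -/
def Consistent (M : PartialMatrix n) (d : ℕ) (K : Finset (Fin n)) (u v : Fin n) : Prop :=
  Module.finrank ℝ (Submodule.span ℝ (insert (ones K)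
    (M.col K '' (insert v (M.nbrs K u v) : Finset (Fin n))))) ≤ d + 2 ∧
  (M.Dep K (M.nbrs K u v) v → M.Dep (insert u K) (M.nbrs K u v) v)

theorem RealizableOn.consistent {d : ℕ} {A K : Finset (Fin n)} {u v : Fin n}
    (hA : M.RealizableOn d A) (hKA : K ⊆ A) (hK : ∀ i ∈ K, ∀ j ∈ K, M.Adj i j)
    (hu : u ∈ A) (hv : v ∈ K) (huv : M.Adj u v) : M.Consistent d K u v := by
  have hsub : M.nbrs K u v ⊆ K := Finset.filter_subset _ _
  refine ⟨le_trans (Submodule.finrank_mono (Submodule.span_mono ?_)) (hA.finrank_le hKA hK), ?_⟩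
  · exact Set.insert_subset_insert (Set.image_mono
      (Finset.coe_subset.2 (Finset.insert_subset hv hsub)))
  · exact hA.dep_insert hKA hK hu hv huv hsub (fun s hs => (Finset.mem_filter.1 hs).2.1)
      (by simp [nbrs])

/-- For `u = v` the weights sum to zero while the weight of `v` is `1`, so some other point of `K`
carries weight. -/
theorem Redundant.erase_nonempty {A K : Finset (Fin n)} {v : Fin n} (hKA : K ⊆ A) (hv : v ∈ K)
    (h : M.Redundant A K v) : (A.erase v).Nonempty := by
  have h1 := h v (hKA hv) (M.adj_self v)
  rw [dep_iff (by simp [nbrs])] at h1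
  obtain ⟨e, c, h1, h2, h0, -⟩ := h1
  by_contra hcon
  rw [Finset.not_nonempty_iff_eq_empty] at hcon
  have : ∑ i, e i = 1 := by
    rw [Finset.sum_eq_single v, h2]
    · intro i _ hi
      refine h1 i (fun hi' => ?_) hi
      have : i ∈ A.erase v := Finset.mem_erase.2 ⟨hi, hKA (Finset.mem_filter.1 hi').1⟩
      rw [hcon] at this
      simp at this
    · simp
  rw [h0] at this
  exact zero_ne_one this

/-- In a clique the neighbours of `v` are all of `K`, so the test at `u = v` bounds the full rank.
By consistency, a dependence that fails on the rows in `insert u K` already fails on those in `K`;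
this yields the coloops. -/
theorem bounded_of_not_redundant {d : ℕ} (hd : 1 ≤ d) {A K : Finset (Fin n)}
    (hKA : K ⊆ A) (hK : ∀ i ∈ K, ∀ j ∈ K, M.Adj i j)
    (hsize : ∀ t L, 1 ≤ t → 1 ≤ L → NoBlock M.Adj t → 2 * t * (8 * L) ^ t < A.card → L ≤ K.card)
    (hcons : ∀ v ∈ K, ∀ u ∈ A, M.Adj u v → M.Consistent d K u v)
    (hred : ∀ v ∈ K, ¬ M.Redundant A K v) : M.Bounded d A.card := by
  refine bounded_of_coloops hd hsize ?_ fun v hv => ?_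
  · rcases K.eq_empty_or_nonempty with rfl | ⟨v, hv⟩
    · have h : insert (ones ∅) (M.col ∅ '' ((∅ : Finset (Fin n)) : Set (Fin n))) = {ones ∅} := by
        simp
      rw [h]
      exact (finrank_span_le_card (R := ℝ) {ones (∅ : Finset (Fin n))}).trans (by simp)
    · have h := (hcons v hv v (hKA hv) (M.adj_self v)).1
      have : insert v (M.nbrs K v v) = K := by
        ext i
        simp only [nbrs, Finset.mem_insert, Finset.mem_filter]
        constructor
        · rintro (rfl | h)
          exacts [hv, h.1]
        · intro hi
          by_cases hiv : i = v
          · exact .inl hiv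
          · exact .inr ⟨hi, hK v hv i hi, hiv⟩
      rwa [this] at h
  · have h := hred v hv
    simp only [Redundant, not_forall] at h
    obtain ⟨u, hu, huv, hdep⟩ := h
    exact ⟨u, huv, fun h => hdep ((hcons v hv u hu huv).2 h)⟩

theorem Bounded.mono {d m m' : ℕ} (h : M.Bounded d m') (hm : m ≤ m') : M.Bounded d m :=
  fun t ht hM => hm.trans (h t ht hM)

end PartialMatrix

/-! ### Search for a redundant point and one deletion round. -/

namespace RealRAM

namespace Code

attribute [local simp] run_skip run_setN run_setR run_seq run_ite State.nat_setNat
  State.real_setNat State.nat_setReal State.real_setReal NatExpr.eval RealExpr.eval Cond.Holds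

/-! #### The search for a redundant point

Variable `34` is the point `v`, variable `35` its neighbour `u`. Variable `21` is zero if `v` turns
out not to be redundant, variable `22` is nonzero if there is no realization. -/

def initMasks : Code :=
  forN 0 36 (ite (.conj (.conj (.natLE (.const 1) (get 6 (var 36)))
      (.natLE (.const 1) (.cell 2 (var 35) (var 36))))
      (.neg (.conj (.natLE (var 36) (var 34)) (.natLE (var 34) (var 36)))))
    (setN 7 (var 36) (.const 0) (.const 1)) (setN 7 (var 36) (.const 0) (.const 0)) ;;
    setN 8 (var 36) (.const 0) (get 6 (var 36))) ;;
  setN 7 (var 0) (.const 0) (.const 1) ;; setN 8 (var 0) (.const 0) (.const 1)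

theorem run_initMasks {n : ℕ} {M : PartialMatrix n} {s : State} {K : Finset (Fin n)} {u v : Fin n}
    (hM : HoldsMatrix s M) (hK : HoldsSet s 6 K) (hu : s.nat 35 0 0 = u) (hv : s.nat 34 0 0 = v) :
    HoldsSet (initMasks.run s) 7 (M.nbrs K u v) ∧ (initMasks.run s).nat 7 n 0 = 1 ∧
    HoldsSet (initMasks.run s) 8 K ∧ (initMasks.run s).nat 8 n 0 = 1 := by
  set body := ite (.conj (.conj (.natLE (.const 1) (get 6 (var 36)))
      (.natLE (.const 1) (.cell 2 (var 35) (var 36))))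
      (.neg (.conj (.natLE (var 36) (var 34)) (.natLE (var 34) (var 36)))))
    (setN 7 (var 36) (.const 0) (.const 1)) (setN 7 (var 36) (.const 0) (.const 0)) ;;
    setN 8 (var 36) (.const 0) (get 6 (var 36)) with hbody
  have h := forN_induction (c := 0) (a := 36) (s := s) (p := body)
    (fun k t => ∀ y : Fin n, (y : ℕ) < k →
      t.nat 7 y 0 = (if y ∈ M.nbrs K u v then 1 else 0) ∧ t.nat 8 y 0 = if y ∈ K then 1 else 0)
    (by simp) (by
      intro k t hk hctr hN hR ih y hy
      have e6 : t.nat 6 = s.nat 6 := hN 6 (by decide)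
      have e2 : t.nat 2 = s.nat 2 := hN 2 (by decide)
      have e35 : t.nat 35 = s.nat 35 := hN 35 (by decide)
      have e34 : t.nat 34 = s.nat 34 := hN 34 (by decide)
      have hk' : k < n := by
        have := hM.size
        simpa [this] using hk
      have h6 := hK ⟨k, hk'⟩
      have h2 := hM.adj u ⟨k, hk'⟩
      simp only at h6 h2
      have hkv : (⟨k, hk'⟩ : Fin n) = v ↔ k ≤ v ∧ v ≤ k := by
        rw [Fin.ext_iff, le_antisymm_iff]
      by_cases hyk : (y : ℕ) = k
      · obtain rfl : y = ⟨k, hk'⟩ := Fin.ext hyk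
        simp only [hbody, PartialMatrix.nbrs, Finset.mem_filter, ne_eq, hkv, run_seq, run_ite,
          Cond.Holds, NatExpr.eval, hctr, e6, e2, e35, e34, hu, hv, h6, h2]
        by_cases h1 : (⟨k, hk'⟩ : Fin n) ∈ K <;> by_cases h3 : M.Adj u ⟨k, hk'⟩ <;>
          by_cases h4 : k ≤ v ∧ v ≤ k <;>
          simp [h1, h3, h4, hctr, e6, h6]
      · have := ih y (by omega)
        simp only [hbody, run_seq, run_ite]
        rw [← this.1, ← this.2]
        split_ifs <;> simp [hctr, hyk])
  have hn : s.nat 0 0 0 + 0 = n := by simp [hM.size]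
  rw [hn] at h
  set s₁ := (forN 0 36 body).run s with hs₁
  have hn₁ : s₁.nat 0 0 0 = n := by rw [hs₁, run_nat _ _ (by decide), hM.size]
  have hrun : initMasks.run s = (setN 7 (var 0) (.const 0) (.const 1) ;;
    setN 8 (var 0) (.const 0) (.const 1)).run s₁ := rfl
  rw [hrun]
  refine ⟨fun y => ?_, by simp [hn₁], fun y => ?_, by simp [hn₁]⟩
  · simp [hn₁, y.2.ne, (h y y.2).1]
  · simp [hn₁, y.2.ne, (h y y.2).2]

/-- The dependence is tested on the rows in `K` and then with row `u` added; variable `25` saves the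
first result. Holding first and failing then refutes realizability. The flag in `22` is only ever
raised. -/
def pairTest : Code :=
  initMasks ;; depTest ;; letN 25 (var 23) ;;
  ite (.natLE (var 24) (.add (var 1) (.const 2))) skip (letN 22 (.const 1)) ;;
  setN 8 (var 35) (.const 0) (.const 1) ;; depTest ;;
  ite (.natLE (.const 1) (var 23)) skip (letN 21 (.const 0) ;;
    ite (.natLE (.const 1) (var 25)) (letN 22 (.const 1)) skip)

theorem run_pairTest {n d : ℕ} {M : PartialMatrix n} {s : State} {K : Finset (Fin n)} {u v : Fin n}
    (hM : HoldsMatrix s M) (hd : s.nat 1 0 0 = d) (hK : HoldsSet s 6 K) (hu : s.nat 35 0 0 = u)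
    (hv : s.nat 34 0 0 = v) :
    (1 ≤ (pairTest.run s).nat 21 0 0 ↔
      1 ≤ s.nat 21 0 0 ∧ M.Dep (insert u K) (M.nbrs K u v) v) ∧
    ((pairTest.run s).nat 22 0 0 = 0 ↔ s.nat 22 0 0 = 0 ∧ M.Consistent d K u v) := by
  classical
  obtain ⟨m7, m7n, m8, m8n⟩ := run_initMasks hM hK hu hv
  set s₁ := initMasks.run s with hs₁
  have hM₁ : HoldsMatrix s₁ M :=
    hM.congr (run_nat _ _ (by decide)) (run_nat _ _ (by decide)) (run_real _ _ (by decide))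
  obtain ⟨z1, r1⟩ := run_depTest hM₁ m7 m7n m8 m8n
    (by rw [hs₁, run_nat _ _ (by decide), hv] : s₁.nat 34 0 0 = v)
  set s₂ := depTest.run s₁ with hs₂
  set rankTest : Code := letN 25 (var 23) ;;
    ite (.natLE (var 24) (.add (var 1) (.const 2))) skip (letN 22 (.const 1)) ;;
    setN 8 (var 35) (.const 0) (.const 1) with hrt
  set s₃ := rankTest.run s₂ with hs₃
  have f2 : ∀ a, a ∉ initMasks.natWrites → a ∉ depTest.natWrites → s₂.nat a = s.nat a :=
    fun a h1 h2 => (run_nat _ _ h2).trans (run_nat _ _ h1)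
  have f3 : ∀ a, a ∉ rankTest.natWrites → s₃.nat a = s₂.nat a := fun a h => run_nat _ _ h
  have hM₂ : HoldsMatrix s₂ M :=
    hM₁.congr (run_nat _ _ (by decide)) (run_nat _ _ (by decide)) (run_real _ _ (by decide))
  have hM₃ : HoldsMatrix s₃ M :=
    hM₂.congr (run_nat _ _ (by decide)) (run_nat _ _ (by decide)) (run_real _ _ (by decide))
  have e35 : s₂.nat 35 0 0 = u := by rw [f2 35 (by decide) (by decide), hu]
  have e1 : s₂.nat 1 0 0 = d := by rw [f2 1 (by decide) (by decide), hd]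
  have e22 : s₂.nat 22 = s.nat 22 := f2 22 (by decide) (by decide)
  have e8 : s₂.nat 8 = s₁.nat 8 := run_nat _ _ (by decide)
  have h8 : ∀ y, s₃.nat 8 y 0 = if y = u then 1 else s₁.nat 8 y 0 := by
    intro y
    simp only [hs₃, hrt, run_seq, run_ite]
    split_ifs <;> simp_all
  have h22 : s₃.nat 22 0 0 = if s₂.nat 24 0 0 ≤ d + 2 then s.nat 22 0 0 else 1 := by
    by_cases hle : s₂.nat 24 0 0 ≤ d + 2 <;> simp [hs₃, hrt, hle, e1, e22]
  have h25 : s₃.nat 25 0 0 = s₂.nat 23 0 0 := by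
    by_cases hle : s₂.nat 24 0 0 ≤ d + 2 <;> simp [hs₃, hrt, hle, e1]
  have m8' : HoldsSet s₃ 8 (insert u K) := by
    intro y
    have := m8 y
    rw [h8]
    by_cases hy : y = u
    · simp [hy]
    · have hy' : (y : ℕ) ≠ u := fun h => hy (Fin.ext h)
      simp [hy, hy', this]
  have m8n' : s₃.nat 8 n 0 = 1 := by
    rw [h8, m8n, ite_self]
  have m7' : HoldsSet s₃ 7 (M.nbrs K u v) :=
    m7.congr ((f3 7 (by decide)).trans (run_nat _ _ (by decide)))
  have m7n' : s₃.nat 7 n 0 = 1 := by rw [f3 7 (by decide), hs₂, run_nat _ _ (by decide), m7n]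
  have e34 : s₃.nat 34 0 0 = v := by rw [f3 34 (by decide), f2 34 (by decide) (by decide), hv]
  obtain ⟨z2, -⟩ := run_depTest hM₃ m7' m7n' m8' m8n' e34
  set s₄ := depTest.run s₃ with hs₄
  have g22 : s₄.nat 22 = s₃.nat 22 := run_nat _ _ (by decide)
  have g25 : s₄.nat 25 = s₃.nat 25 := run_nat _ _ (by decide)
  have g21 : s₄.nat 21 0 0 = s.nat 21 0 0 := by
    rw [hs₄, run_nat _ _ (by decide), f3 21 (by decide), f2 21 (by decide) (by decide)]
  have hrun : pairTest.run s = (ite (.natLE (.const 1) (var 23)) skip (letN 21 (.const 0) ;;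
    ite (.natLE (.const 1) (var 25)) (letN 22 (.const 1)) skip)).run s₄ := rfl
  rw [hrun]
  unfold PartialMatrix.Consistent
  rw [← r1]
  by_cases hz2 : M.Dep (insert u K) (M.nbrs K u v) v <;>
    by_cases hz1 : M.Dep K (M.nbrs K u v) v <;>
    by_cases hle : s₂.nat 24 0 0 ≤ d + 2 <;>
    simp [z2, z1, hz2, hz1, h22, h25, hle, g21, g22, g25]

def vertexTest : Code :=
  letN 21 (.const 1) ;;
  forN 0 35 (ite (.conj (.natLE (.const 1) (get 4 (var 35)))
    (.natLE (.const 1) (.cell 2 (var 35) (var 34)))) pairTest skip)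

theorem run_vertexTest {n d : ℕ} {M : PartialMatrix n} {s : State} {A K : Finset (Fin n)}
    {v : Fin n} (hM : HoldsMatrix s M) (hd : s.nat 1 0 0 = d) (hA : HoldsSet s 4 A)
    (hK : HoldsSet s 6 K) (hv : s.nat 34 0 0 = v) :
    (1 ≤ (vertexTest.run s).nat 21 0 0 ↔ M.Redundant A K v) ∧
    ((vertexTest.run s).nat 22 0 0 = 0 ↔
      s.nat 22 0 0 = 0 ∧ ∀ u ∈ A, M.Adj u v → M.Consistent d K u v) := by
  set s₀ := (letN 21 (.const 1)).run s with hs₀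
  have h := forN_induction (c := 0) (a := 35) (s := s₀)
    (p := ite (.conj (.natLE (.const 1) (get 4 (var 35)))
      (.natLE (.const 1) (.cell 2 (var 35) (var 34)))) pairTest skip)
    (fun k t => (1 ≤ t.nat 21 0 0 ↔ ∀ u ∈ A, (u : ℕ) < k → M.Adj u v →
        M.Dep (insert u K) (M.nbrs K u v) v) ∧
      (t.nat 22 0 0 = 0 ↔ s.nat 22 0 0 = 0 ∧
        ∀ u ∈ A, (u : ℕ) < k → M.Adj u v → M.Consistent d K u v))
    (by simp [hs₀]) (by
      intro k t hk hctr hN hR ⟨ih1, ih2⟩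
      have f : ∀ a, a ∉ 35 :: pairTest.natWrites → a ≠ 21 → t.nat a = s.nat a := by
        intro a h1 h2
        rw [hN a (by simpa [natWrites] using h1), hs₀, run_nat _ _ (by simpa [natWrites] using h2)]
      have e4 : t.nat 4 = s.nat 4 := f 4 (by decide) (by decide)
      have e2 : t.nat 2 = s.nat 2 := f 2 (by decide) (by decide)
      have e34 : t.nat 34 0 0 = v := by rw [f 34 (by decide) (by decide), hv]
      have er : t.real 0 = s.real 0 := (hR 0 (by decide)).trans (run_real _ _ (by decide))
      have hk' : k < n := by
        have := hM.size
        simpa [hs₀, this] using hk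
      have h4 := hA ⟨k, hk'⟩
      have h2 := hM.adj ⟨k, hk'⟩ v
      simp only at h4 h2
      have hsplit : ∀ P : Fin n → Prop, (∀ u ∈ A, (u : ℕ) < k + 1 → M.Adj u v → P u) ↔
          (∀ u ∈ A, (u : ℕ) < k → M.Adj u v → P u) ∧
          ((⟨k, hk'⟩ : Fin n) ∈ A → M.Adj ⟨k, hk'⟩ v → P ⟨k, hk'⟩) := by
        intro P
        constructor
        · exact fun h => ⟨fun u hu huk => h u hu (by omega), fun hu => h _ hu (by simp)⟩
        · rintro ⟨h1, h2⟩ u hu huk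
          by_cases huk' : (u : ℕ) = k
          · obtain rfl : u = ⟨k, hk'⟩ := Fin.ext huk'
            exact h2 hu
          · exact h1 u hu (by omega)
      rw [hsplit, hsplit]
      by_cases hc : (⟨k, hk'⟩ : Fin n) ∈ A ∧ M.Adj ⟨k, hk'⟩ v
      · have hp := run_pairTest (u := ⟨k, hk'⟩)
          (hM.congr (f 0 (by decide) (by decide)) e2 er)
          (by rw [f 1 (by decide) (by decide), hd]) (hK.congr (f 6 (by decide) (by decide)))
          hctr e34
        simp only [run_ite, Cond.Holds, NatExpr.eval, hctr, e4, e2, e34, h4, h2, hc.1, hc.2,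
          if_true, le_refl, and_self, State.nat_setNat]
        simp only [Nat.reduceEqDiff, false_and, if_false, hp.1, hp.2, ih1, ih2, true_imp_iff,
          and_assoc, and_self]
      · have hc' : ¬ (1 ≤ (if (⟨k, hk'⟩ : Fin n) ∈ A then 1 else 0) ∧
            1 ≤ (if M.Adj ⟨k, hk'⟩ v then 1 else 0)) := by
          intro h
          apply hc
          constructor
          · by_contra h'; simp [h'] at h
          · by_contra h'; simp [h'] at h
        simp only [run_ite, Cond.Holds, NatExpr.eval, hctr, e4, e2, e34, h4, h2, hc', if_false,
          run_skip, State.nat_setNat]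
        simp only [Nat.reduceEqDiff, false_and, if_false, ih1, ih2]
        tauto)
  have hn : s₀.nat 0 0 0 + 0 = n := by simp [hs₀, hM.size]
  rw [hn] at h
  obtain ⟨h1, h2⟩ := h
  refine ⟨Iff.trans h1 ?_, Iff.trans h2 ?_⟩
  · simp [PartialMatrix.Redundant]
  · simp

/-- The loop does not stop at a redundant point, so all pairs are checked for consistency and the
last redundant point is recorded. -/
def search : Code :=
  letN 19 (.const 0) ;;
  forN 0 34 (ite (.natLE (.const 1) (get 6 (var 34))) (vertexTest ;;
    ite (.natLE (.const 1) (var 21)) (letN 19 (.const 1) ;; letN 20 (var 34)) skip) skip)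

theorem run_search {n d : ℕ} {M : PartialMatrix n} {s : State} {A K : Finset (Fin n)}
    (hM : HoldsMatrix s M) (hd : s.nat 1 0 0 = d) (hA : HoldsSet s 4 A)
    (hK : HoldsSet s 6 K) :
    (((search.run s).nat 19 0 0 = 0 ∧ ∀ v ∈ K, ¬ M.Redundant A K v) ∨
      ((search.run s).nat 19 0 0 = 1 ∧ ∃ v ∈ K, (search.run s).nat 20 0 0 = v ∧
        M.Redundant A K v)) ∧
    ((search.run s).nat 22 0 0 = 0 ↔
      s.nat 22 0 0 = 0 ∧ ∀ v ∈ K, ∀ u ∈ A, M.Adj u v → M.Consistent d K u v) := by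
  set s₀ := (letN 19 (.const 0)).run s with hs₀
  have h := forN_induction (c := 0) (a := 34) (s := s₀)
    (p := ite (.natLE (.const 1) (get 6 (var 34))) (vertexTest ;;
      ite (.natLE (.const 1) (var 21)) (letN 19 (.const 1) ;; letN 20 (var 34)) skip) skip)
    (fun k t => ((t.nat 19 0 0 = 0 ∧ ∀ v ∈ K, (v : ℕ) < k → ¬ M.Redundant A K v) ∨
      (t.nat 19 0 0 = 1 ∧ ∃ v ∈ K, t.nat 20 0 0 = v ∧ M.Redundant A K v)) ∧
      (t.nat 22 0 0 = 0 ↔ s.nat 22 0 0 = 0 ∧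
        ∀ v ∈ K, (v : ℕ) < k → ∀ u ∈ A, M.Adj u v → M.Consistent d K u v))
    (by simp [hs₀]) (by
      intro k t hk hctr hN hR ⟨ih1, ih2⟩
      have e4 : t.nat 4 = s.nat 4 := (hN 4 (by decide)).trans (run_nat _ _ (by decide))
      have e6 : t.nat 6 = s.nat 6 := (hN 6 (by decide)).trans (run_nat _ _ (by decide))
      have e2 : t.nat 2 = s.nat 2 := (hN 2 (by decide)).trans (run_nat _ _ (by decide))
      have e1 : t.nat 1 = s.nat 1 := (hN 1 (by decide)).trans (run_nat _ _ (by decide))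
      have e0 : t.nat 0 = s.nat 0 := (hN 0 (by decide)).trans (run_nat _ _ (by decide))
      have er : t.real 0 = s.real 0 := (hR 0 (by decide)).trans (run_real _ _ (by decide))
      have hk' : k < n := by
        have := hM.size
        simpa [hs₀, this] using hk
      have h6 := hK ⟨k, hk'⟩
      simp only at h6
      have hsplit : ∀ P : Fin n → Prop, (∀ v ∈ K, (v : ℕ) < k + 1 → P v) ↔
          (∀ v ∈ K, (v : ℕ) < k → P v) ∧ ((⟨k, hk'⟩ : Fin n) ∈ K → P ⟨k, hk'⟩) := by
        intro P
        constructor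
        · exact fun h => ⟨fun u hu huk => h u hu (by omega), fun hu => h _ hu (by simp)⟩
        · rintro ⟨h1, h2⟩ u hu huk
          by_cases huk' : (u : ℕ) = k
          · obtain rfl : u = ⟨k, hk'⟩ := Fin.ext huk'
            exact h2 hu
          · exact h1 u hu (by omega)
      rw [hsplit, hsplit]
      by_cases hc : (⟨k, hk'⟩ : Fin n) ∈ K
      · obtain ⟨p1, p2⟩ := run_vertexTest (v := ⟨k, hk'⟩) (hM.congr e0 e2 er)
          (by rw [e1, hd]) (hA.congr e4) (hK.congr e6) hctr
        have c19 : (vertexTest.run t).nat 19 = t.nat 19 := run_nat _ _ (by decide)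
        have c20 : (vertexTest.run t).nat 20 = t.nat 20 := run_nat _ _ (by decide)
        have c34 : (vertexTest.run t).nat 34 0 0 = k := by rw [run_nat _ _ (by decide), hctr]
        by_cases hok : M.Redundant A K ⟨k, hk'⟩
        · have hok' := p1.2 hok
          simp only [run_ite, run_seq, Cond.Holds, NatExpr.eval, hctr, e6, h6, hc, if_true,
            le_refl, hok', run_setN, State.nat_setNat]
          simp only [Nat.reduceEqDiff, false_and, if_false, and_self, if_true, p2, ih2,
            true_imp_iff, and_assoc, and_true, c34]
          exact .inr ⟨trivial, ⟨k, hk'⟩, hc, rfl, hok⟩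
        · have hok' : ¬ 1 ≤ (vertexTest.run t).nat 21 0 0 := fun h => hok (p1.1 h)
          simp only [run_ite, run_seq, Cond.Holds, NatExpr.eval, hctr, e6, h6, hc, if_true,
            le_refl, hok', if_false, run_skip, State.nat_setNat]
          simp only [Nat.reduceEqDiff, if_false, p2, ih2, true_imp_iff, and_assoc,
            c19, c20, hok, not_false_eq_true, and_true]
          exact ih1
      · simp only [run_ite, Cond.Holds, NatExpr.eval, hctr, e6, h6, hc, if_false, run_skip,
          State.nat_setNat]
        simp only [Nat.reduceEqDiff, if_false, Nat.reduceLeDiff, false_imp_iff, and_true]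
        exact ⟨ih1, ih2⟩)
  have hn : s₀.nat 0 0 0 + 0 = n := by simp [hs₀, hM.size]
  rw [hn] at h
  have hrun : search.run s = (forN 0 34 (ite (.natLE (.const 1) (get 6 (var 34))) (vertexTest ;;
    ite (.natLE (.const 1) (var 21)) (letN 19 (.const 1) ;; letN 20 (var 34)) skip) skip)).run s₀ :=
    rfl
  rw [hrun]
  obtain ⟨h1, h2⟩ := h
  refine ⟨?_, Iff.trans h2 ?_⟩
  · rcases h1 with ⟨a, b⟩ | h1
    · exact .inl ⟨a, fun v hv => b v hv v.2⟩
    · exact .inr h1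
  · simp

def round : Code :=
  clique ;; search ;;
  ite (.natLE (.const 1) (var 19)) (setN 4 (var 20) (.const 0) (.const 0)) skip

theorem run_round {n d : ℕ} (hd1 : 1 ≤ d) {M : PartialMatrix n} {s : State} {A : Finset (Fin n)}
    (hM : HoldsMatrix s M) (hd : s.nat 1 0 0 = d) (hA : HoldsSet s 4 A) :
    ∃ A' ⊆ A, HoldsSet (round.run s) 4 A' ∧ (A.Nonempty → A'.Nonempty) ∧
      (M.RealizableOn d A' → M.RealizableOn d A) ∧
      ((round.run s).nat 22 0 0 ≠ 0 → s.nat 22 0 0 ≠ 0 ∨ ¬ M.RealizableOn d A) ∧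
      ((round.run s).nat 22 0 0 = 0 → s.nat 22 0 0 = 0 ∧
        (A'.card + 1 ≤ A.card ∨ M.Bounded d A'.card)) := by
  obtain ⟨K, hK, hKA, hKK, hsize⟩ := run_clique hM hA
  set s₁ := clique.run s with hs₁
  have hM₁ : HoldsMatrix s₁ M :=
    hM.congr (run_nat _ _ (by decide)) (run_nat _ _ (by decide)) (run_real _ _ (by decide))
  have hA₁ : HoldsSet s₁ 4 A := hA.congr (run_nat _ _ (by decide))
  obtain ⟨h1, h2⟩ := run_search hM₁ (by rw [hs₁, run_nat _ _ (by decide), hd]) hA₁ hK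
  set s₂ := search.run s₁ with hs₂
  have hA₂ : HoldsSet s₂ 4 A := hA₁.congr (run_nat _ _ (by decide))
  have e22 : s₁.nat 22 = s.nat 22 := run_nat _ _ (by decide)
  rw [e22] at h2
  have hrun : round.run s = (ite (.natLE (.const 1) (var 19))
    (setN 4 (var 20) (.const 0) (.const 0)) skip).run s₂ := rfl
  -- A newly raised flag means an inconsistent pair, which `RealizableOn.consistent` excludes in a
  -- realizable set.
  have hflag : s₂.nat 22 0 0 ≠ 0 → s.nat 22 0 0 ≠ 0 ∨ ¬ M.RealizableOn d A := by
    intro h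
    rw [ne_eq, h2, not_and_or] at h
    refine h.imp id fun h hreal => h fun v hv u hu huv => hreal.consistent hKA hKK hu hv huv
  rcases h1 with ⟨h19, hno⟩ | ⟨h19, v, hv, h20, hred⟩
  · have : round.run s = s₂ := by simp [hrun, h19]
    rw [this]
    refine ⟨A, subset_rfl, hA₂, id, id, hflag, fun h => ?_⟩
    obtain ⟨h3, h4⟩ := h2.1 h
    exact ⟨h3, .inr (PartialMatrix.bounded_of_not_redundant hd1 hKA hKK hsize h4 hno)⟩
  · have : round.run s = s₂.setNat 4 v 0 0 := by simp [hrun, h19, h20]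
    rw [this]
    have h22 : (s₂.setNat 4 v 0 0).nat 22 0 0 = s₂.nat 22 0 0 := by simp
    rw [h22]
    refine ⟨A.erase v, Finset.erase_subset _ _, fun y => ?_, fun _ => hred.erase_nonempty hKA hv,
      PartialMatrix.RealizableOn.of_erase hKA hKK hv hred, hflag, fun h => ⟨(h2.1 h).1, .inl ?_⟩⟩
    · have := hA₂ y
      by_cases hy : y = v
      · simp [hy]
      · have hy' : (y : ℕ) ≠ v := fun h => hy (Fin.ext h)
        simp [hy, hy', this]
    · rw [Finset.card_erase_add_one (hKA hv)]

end Code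

end RealRAM

/-! ### The complete algorithm and its correctness. -/

namespace RealRAM

namespace Code

attribute [local simp] run_skip run_setN run_setR run_seq run_ite State.nat_setNat
  State.real_setNat State.nat_setReal State.real_setReal NatExpr.eval RealExpr.eval Cond.Holds

/-! #### The main program -/

/-- The border of the Cayley–Menger matrix is written at index `n`, just outside the input; its
corner is `0` already. -/
def setup : Code :=
  forN 0 33 (setN 4 (var 33) (.const 0) (.const 1) ;;
    setR 0 (var 0) (var 33) (.ofNat (.const 1)) ;; setR 0 (var 33) (var 0) (.ofNat (.const 1)))

theorem run_setup {n d : ℕ} (M : PartialMatrix n) :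
    HoldsMatrix (setup.run (input M d)) M ∧
    HoldsSet (setup.run (input M d)) 4 (Finset.univ : Finset (Fin n)) := by
  set s := input M d with hs
  have hn : s.nat 0 0 0 = n := by simp [hs, input]
  have h := forN_induction (c := 0) (a := 33) (s := s)
    (p := setN 4 (var 33) (.const 0) (.const 1) ;;
      setR 0 (var 0) (var 33) (.ofNat (.const 1)) ;; setR 0 (var 33) (var 0) (.ofNat (.const 1)))
    (fun k t => (∀ y < k, t.nat 4 y 0 = 1) ∧
      ∀ i j, t.real 0 i j = if (i = n ∧ j < k) ∨ (j = n ∧ i < k) then 1 else s.real 0 i j)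
    (by simp) (by
      intro k t hk hctr hN hR ⟨ih1, ih2⟩
      have e0 : t.nat 0 0 0 = n := by rw [hN 0 (by decide), hn]
      constructor
      · intro y hy
        by_cases hyk : y = k
        · simp [hctr, hyk]
        · simp [hctr, hyk, ih1 y (by omega)]
      · intro i j
        simp [hctr, e0, ih2]
        grind)
  rw [add_zero, hn] at h
  obtain ⟨h1, h2⟩ := h
  have f0 : (setup.run s).nat 0 = s.nat 0 := run_nat _ _ (by decide)
  have f2 : (setup.run s).nat 2 = s.nat 2 := run_nat _ _ (by decide)
  refine ⟨⟨by rw [f0, hn], fun i j => ?_, fun i j => ?_, fun i => ?_, fun i => ?_, ?_⟩,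
    fun y => (h1 y y.2).trans (by simp)⟩
  · rw [f2]
    simp only [hs, input]
    simp
    rfl
  · refine (h2 i j).trans ?_
    rw [if_neg (by have := i.2; have := j.2; omega)]
    simp [hs, input, PartialMatrix.val]
  · refine (h2 n i).trans ?_
    simp
  · refine (h2 i n).trans ?_
    simp
  · refine (h2 n n).trans ?_
    simp [hs, input]

def listAlive : Code :=
  letN 26 (.const 0) ;;
  forN 0 33 (ite (.natLE (.const 1) (get 4 (var 33)))
    (setN 9 (var 26) (.const 0) (var 33) ;; letN 26 (.add (var 26) (.const 1))) skip)

theorem run_listAlive {n : ℕ} {s : State} {A : Finset (Fin n)} (hn : s.nat 0 0 0 = n)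
    (hA : HoldsSet s 4 A) :
    ∃ (m : ℕ) (f : Fin m ↪o Fin n), (listAlive.run s).nat 26 0 0 = m ∧
      (∀ i : Fin m, (listAlive.run s).nat 9 i 0 = f i) ∧ ∀ a, a ∈ A ↔ ∃ i, f i = a := by
  set s₀ := (letN 26 (.const 0)).run s with hs₀
  have h := forN_induction (c := 0) (a := 33) (s := s₀)
    (p := ite (.natLE (.const 1) (get 4 (var 33)))
      (setN 9 (var 26) (.const 0) (var 33) ;; letN 26 (.add (var 26) (.const 1))) skip)
    (fun k t => (∀ i < t.nat 26 0 0, t.nat 9 i 0 < k ∧ ∃ a ∈ A, t.nat 9 i 0 = (a : ℕ)) ∧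
      (∀ i j, i < j → j < t.nat 26 0 0 → t.nat 9 i 0 < t.nat 9 j 0) ∧
      (∀ a ∈ A, (a : ℕ) < k → ∃ i < t.nat 26 0 0, t.nat 9 i 0 = a))
    (by simp [hs₀]) (by
      intro k t hk hctr hN hR ⟨ih1, ih2, ih3⟩
      have e4 : t.nat 4 = s.nat 4 := (hN 4 (by decide)).trans (run_nat _ _ (by decide))
      have hk' : k < n := by simpa [hs₀, hn] using hk
      have h4 := hA ⟨k, hk'⟩
      simp only at h4
      by_cases hc : (⟨k, hk'⟩ : Fin n) ∈ A
      · set t' := ((ite (.natLE (.const 1) (get 4 (var 33)))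
          (setN 9 (var 26) (.const 0) (var 33) ;; letN 26 (.add (var 26) (.const 1))) skip).run
            t).setNat 33 0 0 (k + 1) with ht'
        have g26 : t'.nat 26 0 0 = t.nat 26 0 0 + 1 := by simp [ht', hctr, e4, h4, hc]
        have g9 : ∀ i, t'.nat 9 i 0 = if i = t.nat 26 0 0 then k else t.nat 9 i 0 := by
          intro i
          simp [ht', hctr, e4, h4, hc]
        simp only [g26, g9]
        refine ⟨fun i hi => ?_, fun i j hij hj => ?_, fun a ha hak => ?_⟩
        · by_cases hi' : i = t.nat 26 0 0
          · simp only [hi', if_true]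
            exact ⟨by omega, ⟨k, hk'⟩, hc, rfl⟩
          · simp only [hi', if_false]
            obtain ⟨h1, h2⟩ := ih1 i (by omega)
            exact ⟨by omega, h2⟩
        · by_cases hj' : j = t.nat 26 0 0
          · have hi' : i ≠ t.nat 26 0 0 := by omega
            simp only [hj', hi', if_true, if_false]
            exact (ih1 i (by omega)).1
          · have hi' : i ≠ t.nat 26 0 0 := by omega
            simp only [hj', hi', if_false]
            exact ih2 i j hij (by omega)
        · by_cases hak' : (a : ℕ) = k
          · exact ⟨t.nat 26 0 0, by omega, by simp [hak']⟩
          · obtain ⟨i, hi, hia⟩ := ih3 a ha (by omega)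
            exact ⟨i, by omega, by simp [hi.ne, hia]⟩
      · simp only [run_ite, Cond.Holds, NatExpr.eval, hctr, e4, h4, hc, if_false, run_skip,
          State.nat_setNat, Nat.reduceEqDiff, false_and, Nat.reduceLeDiff]
        refine ⟨fun i hi => ?_, ih2, fun a ha hak => ?_⟩
        · obtain ⟨h1, h2⟩ := ih1 i hi
          exact ⟨by omega, h2⟩
        · refine ih3 a ha ?_
          by_contra hcon
          obtain rfl : a = ⟨k, hk'⟩ := Fin.ext (by simp only; omega)
          exact hc ha)
  have hn₀ : s₀.nat 0 0 0 + 0 = n := by simp [hs₀, hn]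
  rw [hn₀] at h
  obtain ⟨h1, h2, h3⟩ := h
  set t := (forN 0 33 (ite (.natLE (.const 1) (get 4 (var 33)))
      (setN 9 (var 26) (.const 0) (var 33) ;; letN 26 (.add (var 26) (.const 1))) skip)).run s₀
    with ht
  refine ⟨t.nat 26 0 0, OrderEmbedding.ofStrictMono
    (fun i => (⟨t.nat 9 i 0, (h1 i i.2).1⟩ : Fin n)) (fun i j hij => h2 i j hij j.2), rfl,
    fun i => rfl, fun a => ⟨fun ha => ?_, ?_⟩⟩
  · obtain ⟨i, hi, hia⟩ := h3 a ha a.2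
    exact ⟨⟨i, hi⟩, Fin.ext hia⟩
  · rintro ⟨i, rfl⟩
    obtain ⟨a, ha, hia⟩ := (h1 i i.2).2
    have : (OrderEmbedding.ofStrictMono (fun i : Fin (t.nat 26 0 0) =>
      (⟨t.nat 9 i 0, (h1 i i.2).1⟩ : Fin n)) (fun i j hij => h2 i j hij j.2)) i = a := Fin.ext hia
    rwa [this]

def copyOutRow : Code :=
  forN 0 38 (setN 40 (var 36) (var 38) (.cell 2 (get 9 (var 36)) (get 9 (var 38))) ;;
    setR 5 (var 36) (var 38) (.cell 0 (get 9 (var 36)) (get 9 (var 38))))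

theorem run_copyOutRow (s : State) (i k : ℕ) :
    ((copyOutRow.run s).nat 40 i k = if i = s.nat 36 0 0 ∧ k < s.nat 0 0 0 then
      s.nat 2 (s.nat 9 i 0) (s.nat 9 k 0) else s.nat 40 i k) ∧
    ((copyOutRow.run s).real 5 i k = if i = s.nat 36 0 0 ∧ k < s.nat 0 0 0 then
      s.real 0 (s.nat 9 i 0) (s.nat 9 k 0) else s.real 5 i k) := by
  revert i k
  refine forN_induction (c := 0) (fun K t => ∀ i k,
    (t.nat 40 i k = if i = s.nat 36 0 0 ∧ k < K then
      s.nat 2 (s.nat 9 i 0) (s.nat 9 k 0) else s.nat 40 i k) ∧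
    (t.real 5 i k = if i = s.nat 36 0 0 ∧ k < K then
      s.real 0 (s.nat 9 i 0) (s.nat 9 k 0) else s.real 5 i k)) (by simp) ?_
  intro K t hK hctr hN hR ih i k
  obtain ⟨ih1, ih2⟩ := ih i k
  simp [hctr, hN 36 (by decide), hN 2 (by decide), hN 9 (by decide), hR 0 (by decide), ih1, ih2]
  grind

/-- The submatrix passes through scratch arrays, so that no entry is overwritten before it is read.
-/
def copyOut : Code := forN 0 36 copyOutRow

theorem run_copyOut {n : ℕ} (s : State) (hn : s.nat 0 0 0 = n) {i k : ℕ} (hi : i < n)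
    (hk : k < n) :
    (copyOut.run s).nat 40 i k = s.nat 2 (s.nat 9 i 0) (s.nat 9 k 0) ∧
    (copyOut.run s).real 5 i k = s.real 0 (s.nat 9 i 0) (s.nat 9 k 0) := by
  have h := forN_induction (c := 0) (a := 36) (s := s) (p := copyOutRow)
    (fun I t => ∀ i < I, t.nat 40 i k = s.nat 2 (s.nat 9 i 0) (s.nat 9 k 0) ∧
      t.real 5 i k = s.real 0 (s.nat 9 i 0) (s.nat 9 k 0)) (by simp) (by
      intro I t hI hctr hN hR ih i hi
      obtain ⟨h1, h2⟩ := run_copyOutRow t i k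
      have e0 : t.nat 0 0 0 = n := by rw [hN 0 (by decide), hn]
      rw [hctr, e0, hN 2 (by decide), hN 9 (by decide)] at h1
      rw [hctr, e0, hR 0 (by decide), hN 9 (by decide)] at h2
      by_cases hiI : i = I
      · subst hiI
        simp [h1, h2, hk]
      · simp [h1, h2, hiI, ih i (by omega)])
  rw [add_zero, hn] at h
  exact h i hi

def copyBackRow : Code :=
  forN 0 38 (setN 2 (var 36) (var 38) (.cell 40 (var 36) (var 38)) ;;
    setR 0 (var 36) (var 38) (.cell 5 (var 36) (var 38)))

theorem run_copyBackRow (s : State) (i k : ℕ) :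
    ((copyBackRow.run s).nat 2 i k = if i = s.nat 36 0 0 ∧ k < s.nat 0 0 0 then
      s.nat 40 i k else s.nat 2 i k) ∧
    ((copyBackRow.run s).real 0 i k = if i = s.nat 36 0 0 ∧ k < s.nat 0 0 0 then
      s.real 5 i k else s.real 0 i k) := by
  revert i k
  refine forN_induction (c := 0) (fun K t => ∀ i k,
    (t.nat 2 i k = if i = s.nat 36 0 0 ∧ k < K then s.nat 40 i k else s.nat 2 i k) ∧
    (t.real 0 i k = if i = s.nat 36 0 0 ∧ k < K then s.real 5 i k else s.real 0 i k)) (by simp) ?_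
  intro K t hK hctr hN hR ih i k
  obtain ⟨ih1, ih2⟩ := ih i k
  simp [hctr, hN 36 (by decide), hN 40 (by decide), hR 5 (by decide), ih1, ih2]
  grind

def copyBack : Code := forN 0 36 copyBackRow

theorem run_copyBack {n : ℕ} (s : State) (hn : s.nat 0 0 0 = n) {i k : ℕ} (hi : i < n)
    (hk : k < n) :
    (copyBack.run s).nat 2 i k = s.nat 40 i k ∧ (copyBack.run s).real 0 i k = s.real 5 i k := by
  have h := forN_induction (c := 0) (a := 36) (s := s) (p := copyBackRow)
    (fun I t => ∀ i < I, t.nat 2 i k = s.nat 40 i k ∧ t.real 0 i k = s.real 5 i k) (by simp) (by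
      intro I t hI hctr hN hR ih i hi
      obtain ⟨h1, h2⟩ := run_copyBackRow t i k
      have e0 : t.nat 0 0 0 = n := by rw [hN 0 (by decide), hn]
      rw [hctr, e0, hN 40 (by decide)] at h1
      rw [hctr, e0, hR 5 (by decide)] at h2
      by_cases hiI : i = I
      · subst hiI
        simp [h1, h2, hk]
      · simp [h1, h2, hiI, ih i (by omega)])
  rw [add_zero, hn] at h
  exact h i hi

def compact : Code := listAlive ;; copyOut ;; copyBack

/-- The encoding is claimed for any state that agrees on the relevant arrays, because the new size
is stored only later. -/
theorem run_compact {n d : ℕ} {M : PartialMatrix n} {s : State} {A : Finset (Fin n)}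
    (hM : HoldsMatrix s M) (hd : s.nat 1 0 0 = d) (hA : HoldsSet s 4 A) :
    ∃ (m : ℕ) (f : Fin m ↪o Fin n), (∀ a, a ∈ A ↔ ∃ i, f i = a) ∧
      (compact.run s).nat 26 0 0 = m ∧
      ∀ t : State, t.nat 0 0 0 = m → t.nat 1 = (compact.run s).nat 1 →
        t.nat 2 = (compact.run s).nat 2 → t.real 0 = (compact.run s).real 0 →
        Encodes t (M.principal f) d := by
  obtain ⟨m, f, h26, h9, hf⟩ := run_listAlive hM.size hA
  set s₁ := listAlive.run s with hs₁
  set s₂ := copyOut.run s₁ with hs₂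
  have hmn : m ≤ n := by simpa using Fintype.card_le_of_embedding f.toEmbedding
  have n1 : s₁.nat 0 0 0 = n := by rw [hs₁, run_nat _ _ (by decide), hM.size]
  have n2 : s₂.nat 0 0 0 = n := by rw [hs₂, run_nat _ _ (by decide), n1]
  have e2 : s₁.nat 2 = s.nat 2 := run_nat _ _ (by decide)
  have er : s₁.real 0 = s.real 0 := run_real _ _ (by decide)
  have hrun : compact.run s = copyBack.run s₂ := rfl
  refine ⟨m, f, hf, ?_, fun t t0 t1 t2 tr => ⟨t0, ?_, fun i j => ?_⟩⟩
  · rw [hrun, run_nat _ _ (by decide), hs₂, run_nat _ _ (by decide), h26]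
  · rw [t1, run_nat _ _ (by decide), hd]
  · have hi : (i : ℕ) < n := i.2.trans_le hmn
    have hj : (j : ℕ) < n := j.2.trans_le hmn
    obtain ⟨b1, b2⟩ := run_copyBack s₂ n2 hi hj
    obtain ⟨c1, c2⟩ := run_copyOut s₁ n1 hi hj
    rw [t2, tr, hrun, b1, b2, c1, c2, h9, h9, e2, er, hM.adj, hM.entry]
    refine ⟨rfl, fun x hx => ?_⟩
    have hx' : M.entry (f i) (f j) = some x := hx
    simp [PartialMatrix.val, hx']

/-- The verdict cell still holds its initial `0`, which is "no". The empty instance is answered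
"yes", since an output matrix must be nonempty. -/
def answer : Code :=
  ite (.natLE (.const 1) (var 22)) skip
    (ite (.natLE (var 0) (.const 0)) (letN 3 (.const 1)) (letN 3 (.const 2)))

/-- Cell `(0, 0)` of array `0` bounds every loop, so the new size is written there only at the very
end. -/
def main : Code :=
  setup ;; forN 0 30 round ;; compact ;; answer ;; letN 0 (var 26)

theorem main_wf : main.WF := by
  simp [main, setup, round, clique, initClique, pickBest, countNbrs, addBest, dropNonNbrs,
    search, vertexTest, pairTest, initMasks, depTest, buildRow, buildLast, ortho, orthoStep,
    copyRow, elimRow, dotLoop, subRow, normLoop, compact, listAlive, copyOut, copyOutRow, copyBack,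
    copyBackRow, answer, WF, natWrites]

/-- While the flag is down, a round either deletes a point or certifies the bound, and the bound
survives further deletions. -/
theorem run_rounds {n d : ℕ} (hd1 : 1 ≤ d) {M : PartialMatrix n} {s : State}
    (hM : HoldsMatrix s M) (hd : s.nat 1 0 0 = d)
    (hA : HoldsSet s 4 (Finset.univ : Finset (Fin n))) (h22 : s.nat 22 0 0 = 0) :
    ∃ A : Finset (Fin n), HoldsSet ((forN 0 30 round).run s) 4 A ∧ (0 < n → A.Nonempty) ∧
      (M.RealizableOn d A → M.Completable d) ∧
      (((forN 0 30 round).run s).nat 22 0 0 ≠ 0 → ¬ M.Completable d) ∧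
      (((forN 0 30 round).run s).nat 22 0 0 = 0 → 0 < n → M.Bounded d A.card) := by
  simp only [PartialMatrix.completable_iff]
  have h := forN_induction (c := 0) (a := 30) (s := s) (p := round)
    (fun r t => ∃ A : Finset (Fin n), HoldsSet t 4 A ∧ (0 < n → A.Nonempty) ∧
      (M.RealizableOn d A → M.RealizableOn d Finset.univ) ∧
      (t.nat 22 0 0 ≠ 0 → ¬ M.RealizableOn d Finset.univ) ∧
      (t.nat 22 0 0 = 0 → A.card + r ≤ n ∨ M.Bounded d A.card))
    (by
      refine ⟨Finset.univ, hA.congr rfl, fun h => ⟨⟨0, h⟩, by simp⟩, id, ?_, fun _ => .inl ?_⟩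
      · simp [h22]
      · simp) (by
      rintro r t hr hctr hN hR ⟨A, hA, hne, hreal, hflag, hbd⟩
      obtain ⟨A', hA'A, hA', hne', hreal', hflag', hbd'⟩ := run_round hd1
        (hM.congr (hN 0 (by decide)) (hN 2 (by decide)) (hR 0 (by decide)))
        (by rw [hN 1 (by decide), hd]) hA
      have e22 : ((round.run t).setNat 30 0 0 (r + 1)).nat 22 0 0 = (round.run t).nat 22 0 0 := by
        simp
      rw [e22]
      refine ⟨A', hA'.congr rfl, fun h => hne' (hne h), fun h => hreal (hreal' h), fun h => ?_,
        fun h => ?_⟩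
      · rcases hflag' h with h | h
        · exact hflag h
        · exact fun hu => h (hu.mono (Finset.subset_univ _))
      · obtain ⟨h1, h2⟩ := hbd' h
        rcases h2 with h2 | h2
        · rcases hbd h1 with h3 | h3
          · exact .inl (by omega)
          · exact .inr (h3.mono (Finset.card_le_card hA'A))
        · exact .inr h2)
  have hn : s.nat 0 0 0 + 0 = n := by simp [hM.size]
  rw [hn] at h
  obtain ⟨A, h1, h2, h3, h4, h5⟩ := h
  refine ⟨A, h1, h2, h3, h4, fun h hn => ?_⟩
  -- After `n` rounds, `A.card + n ≤ n` would make `A` empty, but deletions never empty it.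
  rcases h5 h with h6 | h6
  · have := (h2 hn).card_pos
    omega
  · exact h6

theorem run_main {n d : ℕ} (hd1 : 1 ≤ d) (M : PartialMatrix n) :
    ((main.run (input M d)).verdict = 0 ∧ ¬ M.Completable d) ∨
    ((main.run (input M d)).verdict = 1 ∧ M.Completable d) ∨
    ((main.run (input M d)).verdict = 2 ∧ ∃ (m : ℕ) (f : Fin m ↪o Fin n), 1 ≤ m ∧
      Encodes (main.run (input M d)) (M.principal f) d ∧
      ((M.principal f).Completable d ↔ M.Completable d) ∧ M.Bounded d m) := by
  set s := input M d with hs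
  obtain ⟨hM₁, hA₁⟩ := run_setup (d := d) M
  rw [← hs] at hM₁ hA₁
  set s₁ := setup.run s with hs₁
  have d1 : s₁.nat 1 0 0 = d := by
    rw [hs₁, run_nat _ _ (by decide)]
    simp [hs, input]
  have z1 : s₁.nat 22 0 0 = 0 := by
    rw [hs₁, run_nat _ _ (by decide)]
    simp [hs, input]
  have z3 : s₁.nat 3 0 0 = 0 := by
    rw [hs₁, run_nat _ _ (by decide)]
    simp [hs, input]
  obtain ⟨A, hA, hne, hreal, hflag, hbd⟩ := run_rounds hd1 hM₁ d1 hA₁ z1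
  set s₂ := (forN 0 30 round).run s₁ with hs₂
  have hM₂ : HoldsMatrix s₂ M :=
    hM₁.congr (run_nat _ _ (by decide)) (run_nat _ _ (by decide)) (run_real _ _ (by decide))
  have d2 : s₂.nat 1 0 0 = d := by rw [hs₂, run_nat _ _ (by decide), d1]
  obtain ⟨m, f, hf, h26, henc⟩ := run_compact hM₂ d2 hA
  set s₃ := compact.run s₂ with hs₃
  have n3 : s₃.nat 0 0 0 = n := by rw [hs₃, run_nat _ _ (by decide), hM₂.size]
  have v3 : s₃.nat 3 0 0 = 0 := by
    rw [hs₃, run_nat _ _ (by decide), hs₂, run_nat _ _ (by decide), z3]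
  have f3 : s₃.nat 22 = s₂.nat 22 := run_nat _ _ (by decide)
  have hrun : main.run s = (letN 0 (var 26)).run (answer.run s₃) := rfl
  have henc' : Encodes (main.run s) (M.principal f) d := by
    rw [hrun]
    have a26 : (answer.run s₃).nat 26 0 0 = m := by rw [run_nat _ _ (by decide), h26]
    refine henc _ (by simp [a26]) ?_ ?_ ?_
    · rw [run_nat _ _ (by decide), run_nat _ _ (by decide)]
    · rw [run_nat _ _ (by decide), run_nat _ _ (by decide)]
    · rw [run_real _ _ (by decide), run_real _ _ (by decide)]
  have hv : (main.run s).verdict =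
      if 1 ≤ s₂.nat 22 0 0 then 0 else if n ≤ 0 then 1 else 2 := by
    rw [State.verdict, hrun, run_nat _ _ (by decide)]
    simp only [answer, run_ite, Cond.Holds, NatExpr.eval, f3, n3]
    split_ifs <;> simp [v3]
  rw [hv]
  by_cases h22 : 1 ≤ s₂.nat 22 0 0
  · rw [if_pos h22]
    exact .inl ⟨rfl, hflag (by omega)⟩
  rw [if_neg h22]
  by_cases hn : n ≤ 0
  · rw [if_pos hn]
    obtain rfl : n = 0 := by omega
    exact .inr (.inl ⟨rfl, (M.completable_iff d).2 ⟨fun _ => 0, fun i => i.elim0⟩⟩)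
  rw [if_neg hn]
  have hcard : m = A.card := by
    have : A = Finset.univ.map f.toEmbedding := by
      ext a
      simp [hf a]
    simp [this]
  refine .inr (.inr ⟨rfl, m, f, ?_, henc', ?_, ?_⟩)
  · rw [hcard]
    exact (hne (by omega)).card_pos
  · rw [M.completable_principal_iff f A hf]
    exact ⟨hreal, fun h => ((M.completable_iff d).1 h).mono (Finset.subset_univ _)⟩
  · rw [hcard]
    exact hbd (by omega) (by omega)

end Code

end RealRAM

theorem theorem1p2 :
    ∃ (P : RealRAM.Prog) (T : Polynomial ℕ) (C : ℕ),
      ∀ (n d : ℕ) (M : PartialMatrix n), 1 ≤ d →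
        ∃ (s : RealRAM.State) (k : ℕ),
          RealRAM.Exec P (RealRAM.input M d) s k ∧ k ≤ T.eval n ∧
          ((s.verdict = 0 ∧ ¬ M.Completable d) ∨
           (s.verdict = 1 ∧ M.Completable d) ∨
           (s.verdict = 2 ∧ ∃ (m : ℕ) (f : Fin m ↪o Fin n), 1 ≤ m ∧
              RealRAM.Encodes s (M.principal f) d ∧
              ((M.principal f).Completable d ↔ M.Completable d) ∧
              ∀ t : ℕ, 1 ≤ t → M.ExcludesBlock t → m ≤ (d + 1) ^ (C * t ^ 2))) := by
  -- The exponent constant `20` comes from `compression_bound`, the polynomial from the structure of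
  -- the program.
  refine ⟨RealRAM.Code.main.toProg, RealRAM.Code.main.time, 20, fun n d M hd => ?_⟩
  obtain ⟨k, hk, hkT⟩ := RealRAM.Code.main.exec_run RealRAM.Code.main_wf (RealRAM.input M d)
  exact ⟨_, k, hk, hkT, RealRAM.Code.run_main hd M⟩
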